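/- Let $a,c<0$, $b,w\in\mathbb R$ with $|w|<\min\left(1,\frac{\sqrt{ac}}{|b|}\right)$ (for $b=0$ this is read as $|w|<1$). Let $\varphi,\psi\in C^2(\mathbb R;\mathbb R)$, not both identically zero and both vanishing at $\pm\infty$, be a travelling wave profile of speed $w$ of the Boussinesq `abc' system $$\eta_t+u_x+(\eta u)_x+a u_{xxx}-b\eta_{xxt}=0,\qquad u_t+\eta_x+u u_x+c\,\eta_{xxx}-b u_{xxt}=0,$$ that is, a solution on $\mathbb R$ of $$(1+c\partial_x^2)\varphi-w(1-b\partial_x^2)\psi+\frac{\psi^2}{2}=0,\qquad -w(1-b\partial_x^2)\varphi+(1+a\partial_x^2)\psi+\varphi\psi=0.$$ Consider on the complex Hilbert space $L^2(\mathbb R)\times L^2(\mathbb R)$ the operator $$L=\begin{pmatrix}1+c\,\partial_x^2 & b w\,\partial_x^2+\psi-w\\ b w\,\partial_x^2+\psi-w & 1+a\,\partial_x^2+\varphi\end{pmatrix},\qquad D(L)=H^2(\mathbb R)\times H^2(\mathbb R).$$ Then $L$ is self-adjoint and 1. $0$ is an eigenvalue of $L$ with eigenvector $\begin{pmatrix}\varphi'\\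 \psi'\end{pmatrix}$; in particular this vector is nonzero and lies in $D(L)$; 2. there is $\kappa>0$ such that $\sigma_{ess}(L)\subset[\kappa,\infty)$, where $\sigma_{ess}(L)$ is the set of points of the spectrum of $L$ that are not isolated eigenvalues of finite multiplicity. -/

import Mathlib

open MeasureTheory
open scoped ZeroAtInfty Laplacian

noncomputable section

namespace AbcSystem

section Spectrum

variable {E : Type*} [NormedAddCommGroup E] [InnerProductSpace ℂ E]

/-- The resolvent set of an unbounded operator `T`: those `z` for which `T - z` is a bijection
from the domain of `T` onto the space, with bounded inverse. -/
def resolventSet (T : E →ₗ.[ℂ] E) : Set ℂ :=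
  {z | ∃ R : E →L[ℂ] E,
    (∀ x : E, ∃ h : R x ∈ T.domain, T ⟨R x, h⟩ - z • R x = x) ∧
    ∀ u : T.domain, R (T u - z • (u : E)) = u}

/-- The spectrum of an unbounded operator. -/
def spectrum (T : E →ₗ.[ℂ] E) : Set ℂ := (resolventSet T)ᶜ

/-- The kernel of `T - z`, as a subspace of the domain of `T`. -/
def eigenspace (T : E →ₗ.[ℂ] E) (z : ℂ) : Submodule ℂ T.domain :=
  LinearMap.ker (T.toFun - z • T.domain.subtype)

/-- The discrete spectrum of a self-adjoint operator: the isolated points of the spectrum that are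
eigenvalues of finite multiplicity. -/
def discreteSpectrum (T : E →ₗ.[ℂ] E) : Set ℂ :=
  {z | z ∈ spectrum T ∧
    (∃ ε > 0, ∀ z' ∈ spectrum T, z' ≠ z → ε ≤ ‖z' - z‖) ∧
    eigenspace T z ≠ ⊥ ∧ FiniteDimensional ℂ (eigenspace T z)}

/-- The essential spectrum of a self-adjoint operator: the complement of the discrete spectrum in
the spectrum. -/
def essentialSpectrum (T : E →ₗ.[ℂ] E) : Set ℂ := spectrum T \ discreteSpectrum T

end Spectrum

/-- The complex Hilbert space `L²(ℝ)`. -/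
abbrev L2 : Type := Lp ℂ 2 (volume : Measure ℝ)

/-- The complex Hilbert space `L²(ℝ) × L²(ℝ)`. -/
abbrev L2Pair : Type := WithLp 2 (L2 × L2)

/-- The Sobolev space `H²(ℝ)`, as a subspace of `L²(ℝ)`. -/
def H2 : Submodule ℂ L2 where
  carrier := {u | TemperedDistribution.MemSobolev 2 2 (Lp.toTemperedDistributionCLM ℂ volume 2 u)}
  add_mem' {u v} hu hv := by
    simp only [Set.mem_ofPred_eq, map_add] at *
    exact hu.add hv
  zero_mem' := by
    simp only [Set.mem_ofPred_eq, map_zero]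
    exact TemperedDistribution.memSobolev_fun_zero ℝ ℂ 2 2
  smul_mem' z u hu := by
    simp only [Set.mem_ofPred_eq, map_smul] at *
    exact hu.smul z

theorem toTemperedDistributionCLM_injective :
    Function.Injective (Lp.toTemperedDistributionCLM ℂ (volume : Measure ℝ) 2) :=
  LinearMap.ker_eq_bot.1 Lp.ker_toTemperedDistributionCLM_eq_bot

theorem exists_secondDeriv (u : H2) :
    ∃ g : L2, Lp.toTemperedDistributionCLM ℂ volume 2 g =
      Δ (Lp.toTemperedDistributionCLM ℂ volume 2 (u : L2)) := by
  have h := TemperedDistribution.MemSobolev.laplacian u.2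
  rw [sub_self, TemperedDistribution.memSobolev_zero_iff] at h
  obtain ⟨g, hg⟩ := h
  exact ⟨g, hg.symm⟩

/-- The second derivative `H²(ℝ) → L²(ℝ)`, in the sense of tempered distributions (in dimension one
`Δ` is the second derivative). -/
def secondDeriv : H2 →ₗ[ℂ] L2 where
  toFun u := (exists_secondDeriv u).choose
  map_add' u v := by
    apply toTemperedDistributionCLM_injective
    rw [map_add, (exists_secondDeriv _).choose_spec, (exists_secondDeriv _).choose_spec,
      (exists_secondDeriv _).choose_spec, Submodule.coe_add, map_add]
    exact map_add (LineDeriv.laplacianCLM ℝ ℝ _) _ _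
  map_smul' z u := by
    apply toTemperedDistributionCLM_injective
    rw [RingHom.id_apply, map_smul, (exists_secondDeriv _).choose_spec,
      (exists_secondDeriv _).choose_spec, Submodule.coe_smul, map_smul,
      ← TemperedDistribution.laplacianCLM_apply, ← TemperedDistribution.laplacianCLM_apply,
      map_smul]

theorem memLp_mul (φ : C₀(ℝ, ℝ)) (u : L2) :
    MemLp (fun x => (φ x : ℂ) * u x) 2 volume := by
  refine MemLp.of_le_mul (c := ‖φ.toBCF‖) (Lp.memLp u) ?_ (Filter.Eventually.of_forall fun x => ?_)
  · exact (Complex.continuous_ofReal.comp φ.continuous).aestronglyMeasurable.mul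
      (Lp.aestronglyMeasurable u)
  · rw [norm_mul, Complex.norm_real]
    exact mul_le_mul_of_nonneg_right (φ.toBCF.norm_coe_le_norm x) (norm_nonneg _)

/-- Multiplication by a real continuous function vanishing at infinity, on `L²(ℝ)`. -/
def mulPotential (φ : C₀(ℝ, ℝ)) : L2 →ₗ[ℂ] L2 where
  toFun u := (memLp_mul φ u).toLp _
  map_add' u v := by
    rw [← MemLp.toLp_add]
    refine MemLp.toLp_congr _ _ ?_
    filter_upwards [Lp.coeFn_add u v] with x hx
    rw [hx, Pi.add_apply, Pi.add_apply, mul_add]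
  map_smul' z u := by
    rw [RingHom.id_apply, ← MemLp.toLp_const_smul]
    refine MemLp.toLp_congr _ _ ?_
    filter_upwards [Lp.coeFn_smul z u] with x hx
    rw [hx, Pi.smul_apply, Pi.smul_apply, smul_eq_mul, smul_eq_mul, mul_left_comm]

/-- The domain `H²(ℝ) × H²(ℝ)` in `L²(ℝ) × L²(ℝ)`. -/
def H2Pair : Submodule ℂ L2Pair :=
  (H2.prod H2).comap (WithLp.linearEquiv 2 ℂ (L2 × L2)).toLinearMap

/-- The first component `H²(ℝ) × H²(ℝ) → H²(ℝ)`. -/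
def compFst : H2Pair →ₗ[ℂ] H2 where
  toFun u := ⟨u.1.fst, u.2.1⟩
  map_add' _ _ := rfl
  map_smul' _ _ := rfl

/-- The second component `H²(ℝ) × H²(ℝ) → H²(ℝ)`. -/
def compSnd : H2Pair →ₗ[ℂ] H2 where
  toFun u := ⟨u.1.snd, u.2.2⟩
  map_add' _ _ := rfl
  map_smul' _ _ := rfl

/-- The matrix differential operator
`L = [[1 + c ∂ₓ², b w ∂ₓ² + ψ - w], [b w ∂ₓ² + ψ - w, 1 + a ∂ₓ² + φ]]`
on `L²(ℝ) × L²(ℝ)`, with domain `H²(ℝ) × H²(ℝ)`. -/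
def linearizedOperator (a b c w : ℝ) (φ ψ : C₀(ℝ, ℝ)) : L2Pair →ₗ.[ℂ] L2Pair where
  domain := H2Pair
  toFun :=
    let diag₁ : H2 →ₗ[ℂ] L2 := H2.subtype + (c : ℂ) • secondDeriv
    let diag₂ : H2 →ₗ[ℂ] L2 :=
      H2.subtype + (a : ℂ) • secondDeriv + mulPotential φ ∘ₗ H2.subtype
    let off : H2 →ₗ[ℂ] L2 :=
      ((b * w : ℝ) : ℂ) • secondDeriv + mulPotential ψ ∘ₗ H2.subtype - (w : ℂ) • H2.subtype
    (WithLp.linearEquiv 2 ℂ (L2 × L2)).symm.toLinearMap ∘ₗ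
      LinearMap.prod (diag₁ ∘ₗ compFst + off ∘ₗ compSnd) (off ∘ₗ compFst + diag₂ ∘ₗ compSnd)

/-- `(φ, ψ)` is a (classical) travelling-wave profile of speed `w` vanishing at infinity: it solves
`(1 + c ∂ₓ²) φ - w (1 - b ∂ₓ²) ψ + ψ² / 2 = 0` and `-w (1 - b ∂ₓ²) φ + (1 + a ∂ₓ²) ψ + φ ψ = 0`. -/
structure IsTravelingWave (a b c w : ℝ) (φ ψ : C₀(ℝ, ℝ)) : Prop where
  contDiff_fst : ContDiff ℝ 2 φ
  contDiff_snd : ContDiff ℝ 2 ψ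
  eq_fst : ∀ x, (φ x + c * deriv (deriv φ) x) - w * (ψ x - b * deriv (deriv ψ) x)
    + ψ x ^ 2 / 2 = 0
  eq_snd : ∀ x, -w * (φ x - b * deriv (deriv φ) x) + (ψ x + a * deriv (deriv ψ) x)
    + φ x * ψ x = 0

end AbcSystem

end

/-! Write L = L₀ + V with L₀ of constant coefficients and V multiplication by the matrix with
entries 0, ψ, ψ, φ. The second-order part of L₀ has matrix [[-c, -bw], [-bw, -a]] in front of -∂ₓ²,
positive definite because (bw)² < ac; the zeroth-order matrix [[1, -w], [-w, 1]] is at least 1 -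
|w|. Hence L₀ ≥ 1 - |w| > 0 and L₀ controls two derivatives. Self-adjointness of L comes from that
of ∂ₓ² on H² by inverting the second-order matrix.

The potentials are square-integrable, so V is compact from H² to L². For real t < 1 - |w|, bounded
approximate eigenvectors of L at t are therefore relatively compact
(`isWeylCompact_linearizedOperator`), and an abstract argument (`essentialSpectrum_subset_Ici`)
leaves at most isolated eigenvalues of finite multiplicity below κ = 1 - |w|.

Differentiating the profile equations gives L(φ', ψ') = 0. The work is to show that φ', ψ' lie in
H², given only decay to zero. The form f = -cφ² - 2bwφψ - aψ² satisfies f'' ≥ η(φ² + ψ² + φ'² + ψ'²)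
near infinity for some η > 0. As f is convex there and tends to 0, f'' is integrable, which puts φ,
ψ, φ', ψ' in L²; the equations then supply the higher derivatives. -/

noncomputable section

namespace AbcSystem

/-! ### The second derivative on H² through the Bessel potential -/

section Bessel

open scoped FourierTransform SchwartzMap InnerProductSpace
open TemperedDistribution Filter Topology

/-- The symbol `(1 + ‖ξ‖²)⁻¹` of the inverse Bessel potential of order two. -/
def besselSymbol (ξ : ℝ) : ℂ := (((1 + ‖ξ‖ ^ 2) ^ ((-2 : ℝ) / 2) : ℝ) : ℂ)

theorem besselSymbol_eq (ξ : ℝ) : besselSymbol ξ = (((1 + ξ ^ 2)⁻¹ : ℝ) : ℂ) := by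
  rw [besselSymbol, Real.norm_eq_abs, sq_abs, show (-2 : ℝ) / 2 = -1 by norm_num, Real.rpow_neg_one]

theorem hasTemperateGrowth_besselSymbol : besselSymbol.HasTemperateGrowth := by
  unfold besselSymbol; fun_prop

theorem continuous_besselSymbol : Continuous besselSymbol :=
  hasTemperateGrowth_besselSymbol.1.continuous

theorem norm_besselSymbol_le_one (ξ : ℝ) : ‖besselSymbol ξ‖ ≤ 1 := by
  rw [besselSymbol_eq, Complex.norm_real, Real.norm_of_nonneg (by positivity)]
  exact inv_le_one_of_one_le₀ (by nlinarith [sq_nonneg ξ])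

theorem memLp_besselSymbol_mul (u : L2) : MemLp (fun ξ => besselSymbol ξ * u ξ) 2 volume := by
  refine MemLp.of_le_mul (c := 1) (Lp.memLp u) ?_ (Filter.Eventually.of_forall fun x => ?_)
  · exact continuous_besselSymbol.aestronglyMeasurable.mul (Lp.aestronglyMeasurable u)
  · rw [norm_mul]
    exact mul_le_mul_of_nonneg_right (norm_besselSymbol_le_one x) (norm_nonneg _)

/-- Multiplication by the symbol `(1 + ‖ξ‖²)⁻¹` on `L²(ℝ)`. -/
def mulBesselSymbol (u : L2) : L2 := (memLp_besselSymbol_mul u).toLp _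

theorem toTemperedDistribution_mulBesselSymbol (u : L2) :
    Lp.toTemperedDistribution (mulBesselSymbol u) =
      smulLeftCLM ℂ besselSymbol (Lp.toTemperedDistribution u) := by
  ext g
  rw [Lp.toTemperedDistribution_apply, smulLeftCLM_apply_apply, Lp.toTemperedDistribution_apply]
  apply integral_congr_ae
  filter_upwards [(memLp_besselSymbol_mul u).coeFn_toLp] with x hx
  rw [mulBesselSymbol, hx, SchwartzMap.smulLeftCLM_apply_apply hasTemperateGrowth_besselSymbol]
  simp only [smul_eq_mul]
  ring

/-- The inverse Bessel potential of order two on `L²(ℝ)`, with the symbol `(1 + ‖ξ‖²)⁻¹`. -/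
def besselInv (h : L2) : L2 := 𝓕⁻ (mulBesselSymbol (𝓕 h))

theorem toTemperedDistribution_besselInv (h : L2) :
    Lp.toTemperedDistributionCLM ℂ volume 2 (besselInv h) =
      besselPotential ℝ ℂ (-2) (Lp.toTemperedDistributionCLM ℂ volume 2 h) := by
  rw [Lp.toTemperedDistributionCLM_apply, Lp.toTemperedDistributionCLM_apply, besselInv,
    ← Lp.fourierInv_toTemperedDistribution_eq, toTemperedDistribution_mulBesselSymbol,
    ← Lp.fourier_toTemperedDistribution_eq, besselPotential, fourierMultiplierCLM_apply]
  rfl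

theorem besselInv_mem (h : L2) : besselInv h ∈ H2 := by
  refine ⟨h, ?_⟩
  rw [toTemperedDistribution_besselInv, besselPotential_besselPotential_apply]
  simp

/-- The factor `(2π)⁻²` relating the Laplacian to its normalized Fourier symbol. -/
def laplacianScale : ℝ := ((2 * Real.pi) ^ 2)⁻¹

theorem laplacianScale_pos : 0 < laplacianScale := by
  unfold laplacianScale; positivity

/-- With the Fourier kernel exp(-2πixξ) the symbol of Δ is -(2π)²|ξ|², so the symbol 1 + |ξ|²
belongs to 1 - (2π)⁻²Δ. -/
theorem besselPotential_two_eq (f : 𝓢'(ℝ, ℂ)) :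
    besselPotential ℝ ℂ 2 f = f - (laplacianScale : ℂ) • Δ f := by
  have hfun : (fun x : ℝ => ((((1 + ‖x‖ ^ 2) ^ ((2 : ℝ) / 2) : ℝ)) : ℂ)) =
      (fun _ => (1 : ℂ)) + fun x => Complex.ofReal (‖x‖ ^ 2) := by
    ext x
    simp
  rw [laplacian_eq_fourierMultiplierCLM, besselPotential, hfun, fourierMultiplierCLM_apply,
    smulLeftCLM_add (by fun_prop) (by fun_prop), fourierMultiplierCLM_apply]
  rw [← Complex.coe_smul, smul_smul, ← Complex.ofReal_mul, laplacianScale,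
    show ((2 * Real.pi) ^ 2)⁻¹ * -(2 * Real.pi) ^ 2 = -1 by field_simp]
  rw [add_apply, smulLeftCLM_const, one_smul, FourierTransform.fourierInv_add,
    FourierTransform.fourierInv_fourier_eq]
  simp

theorem secondDeriv_spec (u : H2) :
    Lp.toTemperedDistributionCLM ℂ volume 2 (secondDeriv u) =
      Δ (Lp.toTemperedDistributionCLM ℂ volume 2 (u : L2)) :=
  (exists_secondDeriv u).choose_spec

/-- The operator `1 - (2π)⁻² ∂ₓ²` from `H²(ℝ)` to `L²(ℝ)`. -/
def besselOp : H2 →ₗ[ℂ] L2 := H2.subtype - (laplacianScale : ℂ) • secondDeriv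

theorem besselOp_apply (u : H2) :
    besselOp u = (u : L2) - (laplacianScale : ℂ) • secondDeriv u := rfl

theorem toTemperedDistribution_besselOp (u : H2) :
    Lp.toTemperedDistributionCLM ℂ volume 2 (besselOp u) =
      besselPotential ℝ ℂ 2 (Lp.toTemperedDistributionCLM ℂ volume 2 (u : L2)) := by
  rw [besselPotential_two_eq, ← secondDeriv_spec, besselOp_apply, map_sub, map_smul]

theorem besselOp_besselInv (h : L2) : besselOp ⟨besselInv h, besselInv_mem h⟩ = h := by
  apply toTemperedDistributionCLM_injective
  rw [toTemperedDistribution_besselOp, toTemperedDistribution_besselInv,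
    besselPotential_besselPotential_apply]
  simp

theorem besselInv_besselOp (u : H2) : besselInv (besselOp u) = u := by
  apply toTemperedDistributionCLM_injective
  rw [toTemperedDistribution_besselInv, toTemperedDistribution_besselOp,
    besselPotential_besselPotential_apply]
  simp

theorem inner_mulBesselSymbol (u v : L2) :
    ⟪mulBesselSymbol u, v⟫_ℂ = ⟪u, mulBesselSymbol v⟫_ℂ := by
  rw [L2.inner_def, L2.inner_def]
  apply integral_congr_ae
  filter_upwards [(memLp_besselSymbol_mul u).coeFn_toLp, (memLp_besselSymbol_mul v).coeFn_toLp]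
    with x hu hv
  rw [mulBesselSymbol, mulBesselSymbol, hu, hv, besselSymbol_eq]
  simp only [RCLike.inner_apply, map_mul, Complex.conj_ofReal]
  ring

theorem inner_fourierInv_left (u v : L2) : ⟪𝓕⁻ u, v⟫_ℂ = ⟪u, 𝓕 v⟫_ℂ := by
  rw [← Lp.inner_fourier_eq, FourierTransform.fourier_fourierInv_eq]

theorem inner_fourier_left (u v : L2) : ⟪𝓕 u, v⟫_ℂ = ⟪u, 𝓕⁻ v⟫_ℂ := by
  rw [← Lp.inner_fourier_eq u, FourierTransform.fourier_fourierInv_eq]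

theorem inner_besselInv (h k : L2) : ⟪besselInv h, k⟫_ℂ = ⟪h, besselInv k⟫_ℂ := by
  rw [besselInv, besselInv, inner_fourierInv_left, inner_mulBesselSymbol, inner_fourier_left]

theorem fourier_sub_eq (u v : L2) : 𝓕 (u - v) = 𝓕 u - 𝓕 v :=
  (Lp.fourierTransformₗᵢ ℝ ℂ).map_sub u v

/-- On the Fourier side the integrand is m(1 - m)|ĥ|² with 0 ≤ m ≤ 1. For `h = besselOp u` this
becomes the positivity of -∂ₓ². -/
theorem re_inner_sub_besselInv_nonneg (h : L2) :
    0 ≤ (⟪h - besselInv h, besselInv h⟫_ℂ).re := by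
  have key : ⟪h - besselInv h, besselInv h⟫_ℂ =
      ⟪𝓕 h - mulBesselSymbol (𝓕 h), mulBesselSymbol (𝓕 h)⟫_ℂ := by
    rw [besselInv, ← Lp.inner_fourier_eq, fourier_sub_eq,
      FourierTransform.fourier_fourierInv_eq]
  rw [key]
  generalize 𝓕 h = u
  rw [L2.inner_def, ← RCLike.re_eq_complex_re, ← integral_re (L2.integrable_inner _ _)]
  apply integral_nonneg_of_ae
  filter_upwards [(memLp_besselSymbol_mul u).coeFn_toLp, Lp.coeFn_sub u (mulBesselSymbol u)]
    with x hu hs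
  rw [hs, Pi.sub_apply, mulBesselSymbol, hu]
  have h1 : (1 + x ^ 2)⁻¹ ≤ 1 := inv_le_one_of_one_le₀ (by nlinarith [sq_nonneg x])
  have h2 : 0 ≤ (1 + x ^ 2)⁻¹ := by positivity
  have h3 : (⟪u x - besselSymbol x * u x, besselSymbol x * u x⟫_ℂ) =
      (((1 + x ^ 2)⁻¹ * (1 - (1 + x ^ 2)⁻¹) * Complex.normSq (u x) : ℝ) : ℂ) := by
    rw [besselSymbol_eq]
    simp only [RCLike.inner_apply, map_sub, map_mul, Complex.conj_ofReal, Complex.ofReal_mul,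
      Complex.ofReal_sub, Complex.normSq_eq_conj_mul_self, Complex.ofReal_one]
    ring
  rw [h3, RCLike.re_eq_complex_re, Complex.ofReal_re, Pi.zero_apply]
  exact mul_nonneg (mul_nonneg h2 (by linarith)) (Complex.normSq_nonneg _)

theorem besselOp_surjective (h : L2) : ∃ u : H2, besselOp u = h :=
  ⟨_, besselOp_besselInv h⟩

theorem inner_besselOp (u v : H2) : ⟪besselOp u, (v : L2)⟫_ℂ = ⟪(u : L2), besselOp v⟫_ℂ := by
  conv_lhs => rw [← besselInv_besselOp v]
  conv_rhs => rw [← besselInv_besselOp u]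
  exact (inner_besselInv _ _).symm

theorem inner_secondDeriv (u v : H2) :
    ⟪secondDeriv u, (v : L2)⟫_ℂ = ⟪(u : L2), secondDeriv v⟫_ℂ := by
  have h := inner_besselOp u v
  rw [besselOp_apply, besselOp_apply, inner_sub_left, inner_sub_right, inner_smul_left,
    inner_smul_right, Complex.conj_ofReal] at h
  have h0 : (laplacianScale : ℂ) ≠ 0 := Complex.ofReal_ne_zero.2 laplacianScale_pos.ne'
  exact mul_left_cancel₀ h0 (sub_right_injective h)

theorem re_inner_secondDeriv_nonpos (u : H2) : (⟪secondDeriv u, (u : L2)⟫_ℂ).re ≤ 0 := by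
  have h := re_inner_sub_besselInv_nonneg (besselOp u)
  rw [besselInv_besselOp, besselOp_apply, sub_sub_cancel_left, inner_neg_left, inner_smul_left,
    Complex.conj_ofReal, Complex.neg_re, Complex.re_ofReal_mul] at h
  nlinarith [laplacianScale_pos]

/-- `∂ₓ²` with domain `H²(ℝ)` contains its adjoint. -/
theorem mem_H2_of_inner_secondDeriv {v g : L2}
    (h : ∀ u : H2, ⟪secondDeriv u, v⟫_ℂ = ⟪(u : L2), g⟫_ℂ) : v ∈ H2 := by
  -- `besselOp` is onto, so testing against its range identifies v as a value of `besselInv`, hence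
  -- an element of H².
  have key : v = besselInv (v - (laplacianScale : ℂ) • g) := by
    refine ext_inner_left ℂ fun k => ?_
    obtain ⟨u, rfl⟩ := besselOp_surjective k
    rw [← inner_besselInv, besselInv_besselOp, besselOp_apply, inner_sub_left, inner_sub_right,
      inner_smul_left, inner_smul_right, Complex.conj_ofReal, h]
  rw [key]
  exact besselInv_mem _

/-- A vector orthogonal to the range of the symmetric operator `besselInv` lies in its kernel, which
is trivial because `besselOp` is a left inverse. -/
theorem dense_H2 : Dense (H2 : Set L2) := by
  rw [Submodule.dense_iff_topologicalClosure_eq_top, Submodule.topologicalClosure_eq_top_iff,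
    Submodule.eq_bot_iff]
  intro v hv
  have h0 : besselInv v = 0 := by
    refine ext_inner_left ℂ fun k => ?_
    rw [← inner_besselInv, inner_zero_right]
    exact Submodule.inner_right_of_mem_orthogonal (besselInv_mem k) hv
  have h1 := besselOp_besselInv v
  have h2 : (⟨besselInv v, besselInv_mem v⟩ : H2) = 0 := Subtype.ext h0
  rw [h2, map_zero] at h1
  exact h1.symm

end Bessel

/-! ### Compactness and regularity in H² -/

section Sobolev

open scoped FourierTransform SchwartzMap InnerProductSpace
open TemperedDistribution Filter Topology

theorem continuous_neg_inner : Continuous fun p : ℝ × ℝ => (-innerₗ ℝ) p.1 p.2 :=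
  continuous_inner.neg

/-- On `L¹ ∩ L²`, the inverse Fourier transform on `L²` is given by the Fourier integral. -/
theorem fourierInv_ae_eq_of_integrable (v : L2) (hv : Integrable (v : ℝ → ℂ)) :
    ((𝓕⁻ v : L2) : ℝ → ℂ) =ᵐ[volume] 𝓕⁻ (v : ℝ → ℂ) := by
  have hcont : Continuous (𝓕⁻ (v : ℝ → ℂ)) := by
    have := VectorFourier.fourierIntegral_continuous Real.continuous_fourierChar
      (L := -innerₗ ℝ) continuous_neg_inner hv
    exact this
  apply ae_eq_of_integral_contDiff_smul_eq
  · exact (Lp.memLp _).locallyIntegrable (by norm_num)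
  · exact hcont.locallyIntegrable
  intro g g_smooth g_cpt
  have hg₁ : HasCompactSupport (Complex.ofRealCLM ∘ g) := g_cpt.comp_left rfl
  have hg₂ : ContDiff ℝ (⊤ : ℕ∞) (Complex.ofRealCLM ∘ g) := by fun_prop
  let G : 𝓢(ℝ, ℂ) := hg₁.toSchwartzMap hg₂
  have hG : ∀ x, G x = g x := fun x => rfl
  have h1 : ∫ x, g x • (𝓕⁻ v : L2) x = Lp.toTemperedDistribution (𝓕⁻ v : L2) G := by
    rw [Lp.toTemperedDistribution_apply]
    simp [hG]
  -- Both inverse transforms, tested against g, equal the integral of v against the inverse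
  -- transform of g.
  have h2 := VectorFourier.integral_fourierIntegral_smul_eq_flip (L := -innerₗ ℝ)
      Real.continuous_fourierChar continuous_neg_inner (G.integrable (μ := volume)) hv
  have hflip : (-innerₗ ℝ).flip = -innerₗ ℝ := by
    ext; simp
  rw [hflip] at h2
  have h3 : ∀ x, g x • 𝓕⁻ (v : ℝ → ℂ) x = G x • 𝓕⁻ (v : ℝ → ℂ) x := by
    intro x; simp [hG]
  rw [integral_congr_ae (.of_forall h3), h1, ← Lp.fourierInv_toTemperedDistribution_eq,
    fourierInv_apply, Lp.toTemperedDistribution_apply, SchwartzMap.fourierInv_coe]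
  exact h2

/-- A bounded sequence in a separable Hilbert space has a weakly convergent subsequence. -/
theorem exists_subseq_tendsto_inner {E : Type*} [NormedAddCommGroup E] [InnerProductSpace ℂ E]
    [CompleteSpace E] [TopologicalSpace.SeparableSpace E] (u : ℕ → E) (C : ℝ)
    (hu : ∀ n, ‖u n‖ ≤ C) :
    ∃ (v : E) (s : ℕ → ℕ), StrictMono s ∧
      ∀ k : E, Tendsto (fun n => ⟪k, u (s n)⟫_ℂ) atTop (𝓝 ⟪k, v⟫_ℂ) := by
  obtain ⟨l, -, s, hs, hl⟩ := WeakDual.isSeqCompact_closedBall ℂ E 0 C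
    (x := fun n => StrongDual.toWeakDual (InnerProductSpace.toDual ℂ E (u n))) (fun n => by
      simpa using hu n)
  refine ⟨(InnerProductSpace.toDual ℂ E).symm (WeakDual.toStrongDual l), s, hs, fun k => ?_⟩
  have h1 : Tendsto (fun n => ⟪u (s n), k⟫_ℂ) atTop (𝓝 (l k)) := by
    have := ((WeakDual.eval_continuous k).tendsto l).comp hl
    exact this
  have h2 : l k = ⟪(InnerProductSpace.toDual ℂ E).symm (WeakDual.toStrongDual l), k⟫_ℂ := by
    rw [InnerProductSpace.toDual_symm_apply]; rfl
  rw [h2] at h1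
  have h3 := (Complex.continuous_conj.tendsto _).comp h1
  rw [inner_conj_symm] at h3
  exact h3.congr fun n => inner_conj_symm _ _

/-- Since 0 ≤ m ≤ 1, m² ≤ m = (1 + ξ²)⁻¹, which is integrable in dimension one. This is what makes
point evaluation bounded on H². -/
theorem memLp_besselSymbol : MemLp besselSymbol 2 volume := by
  rw [memLp_two_iff_integrable_sq_norm continuous_besselSymbol.aestronglyMeasurable]
  refine integrable_inv_one_add_sq.mono' (by
    exact (continuous_besselSymbol.norm.pow 2).aestronglyMeasurable) ?_
  filter_upwards with x
  have h := norm_besselSymbol_le_one x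
  rw [Real.norm_of_nonneg (by positivity)]
  have h' : ‖besselSymbol x‖ = (1 + x ^ 2)⁻¹ := by
    rw [besselSymbol_eq, Complex.norm_real, Real.norm_of_nonneg (by positivity)]
  nlinarith [norm_nonneg (besselSymbol x)]

/-- The point evaluations of `besselInv h` are given by a bounded family of vectors in `L²(ℝ)`. -/
theorem exists_besselInv_kernel : ∃ (k : ℝ → L2) (C : ℝ), (∀ x, ‖k x‖ ≤ C) ∧
    ∀ h : L2, (besselInv h : ℝ → ℂ) =ᵐ[volume] fun x => ⟪k x, h⟫_ℂ := by
  have hmem : ∀ x : ℝ, MemLp (fun ξ => (starRingEnd ℂ)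
      (Complex.exp ((↑(2 * Real.pi * ⟪ξ, x⟫_ℝ) * Complex.I))) * besselSymbol ξ) 2 volume := by
    intro x
    refine memLp_besselSymbol.of_le (Continuous.aestronglyMeasurable ?_) (.of_forall fun ξ => ?_)
    · have := continuous_besselSymbol
      fun_prop
    · rw [norm_mul, RCLike.norm_conj, Complex.norm_exp_ofReal_mul_I, one_mul]
  -- The kernel at x is the inverse transform of exp(-2πixξ)m(ξ); the phase has modulus one, so its
  -- norm does not depend on x.
  refine ⟨fun x => 𝓕⁻ ((hmem x).toLp _), ‖memLp_besselSymbol.toLp _‖, fun x => ?_, fun h => ?_⟩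
  · rw [← Lp.norm_fourier_eq, FourierTransform.fourier_fourierInv_eq]
    refine Lp.norm_le_norm_of_ae_le ?_
    filter_upwards [(hmem x).coeFn_toLp, memLp_besselSymbol.coeFn_toLp] with ξ h1 h2
    rw [h1, h2, norm_mul, RCLike.norm_conj, Complex.norm_exp_ofReal_mul_I, one_mul]
  · have hint : Integrable (mulBesselSymbol (𝓕 h) : ℝ → ℂ) :=
      (memLp_besselSymbol.integrable_mul (Lp.memLp (𝓕 h))).congr
        (memLp_besselSymbol_mul (𝓕 h)).coeFn_toLp.symm
    filter_upwards [fourierInv_ae_eq_of_integrable _ hint] with x hx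
    rw [besselInv, hx, Real.fourierInv_eq', inner_fourierInv_left, L2.inner_def]
    apply integral_congr_ae
    filter_upwards [(hmem x).coeFn_toLp, (memLp_besselSymbol_mul (𝓕 h)).coeFn_toLp] with ξ h1 h2
    rw [mulBesselSymbol, h1, h2, besselSymbol_eq]
    simp only [RCLike.inner_apply, map_mul, Complex.conj_conj, Complex.conj_ofReal, smul_eq_mul]
    ring

theorem norm_sq_eq_integral (u : L2) : ‖u‖ ^ 2 = ∫ x, ‖u x‖ ^ 2 := by
  have h : (⟪u, u⟫_ℂ).re = ∫ x, ‖u x‖ ^ 2 := by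
    rw [L2.inner_def, ← RCLike.re_eq_complex_re, ← integral_re (L2.integrable_inner _ _)]
    simp_rw [inner_self_eq_norm_sq]
  rw [← h, ← inner_self_eq_norm_sq (𝕜 := ℂ)]
  rfl

/-- Multiplication by a square-integrable potential is compact from `H²(ℝ)` to `L²(ℝ)`. -/
theorem tendsto_mulPotential_besselInv (φ : C₀(ℝ, ℝ)) (hφ : MemLp φ 2 volume) (h : ℕ → L2)
    (v : L2) (C : ℝ) (hh : ∀ n, ‖h n‖ ≤ C)
    (hv : ∀ k : L2, Tendsto (fun n => ⟪k, h n⟫_ℂ) atTop (𝓝 ⟪k, v⟫_ℂ)) :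
    Tendsto (fun n => mulPotential φ (besselInv (h n))) atTop
      (𝓝 (mulPotential φ (besselInv v))) := by
  obtain ⟨k, B, hB, hk⟩ := exists_besselInv_kernel
  rw [tendsto_iff_norm_sub_tendsto_zero]
  have hae : ∀ᵐ x, ∀ n, (mulPotential φ (besselInv (h n)) - mulPotential φ (besselInv v) : L2) x =
      φ x * (⟪k x, h n⟫_ℂ - ⟪k x, v⟫_ℂ) := by
    rw [ae_all_iff]
    intro n
    filter_upwards [Lp.coeFn_sub (mulPotential φ (besselInv (h n))) (mulPotential φ (besselInv v)),
      (memLp_mul φ (besselInv (h n))).coeFn_toLp, (memLp_mul φ (besselInv v)).coeFn_toLp,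
      hk (h n), hk v] with x h1 h2 h3 h4 h5
    rw [h1, Pi.sub_apply]
    change (MemLp.toLp _ (memLp_mul φ (besselInv (h n)))) x -
      (MemLp.toLp _ (memLp_mul φ (besselInv v))) x = _
    rw [h2, h3, h4, h5, mul_sub]
  -- Weak convergence gives pointwise convergence through the kernels, and their uniform bound gives
  -- the dominating function, a constant times φ².
  have hlim : Tendsto (fun n => ∫ x,
      ‖(mulPotential φ (besselInv (h n)) - mulPotential φ (besselInv v) : L2) x‖ ^ 2) atTop
      (𝓝 (∫ _ : ℝ, (0 : ℝ))) := by
    refine tendsto_integral_of_dominated_convergence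
      (fun x => (B * (C + ‖v‖)) ^ 2 * φ x ^ 2) (fun n => ?_) (hφ.integrable_sq.const_mul _)
      (fun n => ?_) ?_
    · exact (Lp.aestronglyMeasurable _).norm.pow 2
    · filter_upwards [hae] with x hx
      rw [Real.norm_of_nonneg (by positivity), hx n, norm_mul, Complex.norm_real, mul_pow,
        Real.norm_eq_abs, sq_abs, mul_comm, ← inner_sub_right]
      have h1 : ‖⟪k x, h n - v⟫_ℂ‖ ≤ B * (C + ‖v‖) := by
        refine (norm_inner_le_norm _ _).trans ?_
        refine mul_le_mul (hB x) ((norm_sub_le _ _).trans (by gcongr; exact hh n))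
          (norm_nonneg _) ((norm_nonneg _).trans (hB x))
      gcongr
    · filter_upwards [hae] with x hx
      simp_rw [hx]
      have h1 := ((hv (k x)).sub_const ⟪k x, v⟫_ℂ).const_mul (φ x : ℂ)
      rw [sub_self, mul_zero] at h1
      simpa using h1.norm.pow 2
  rw [integral_zero] at hlim
  have h2 := (Real.continuous_sqrt.tendsto 0).comp hlim
  rw [Real.sqrt_zero] at h2
  refine h2.congr fun n => ?_
  rw [Function.comp_apply, ← norm_sq_eq_integral, Real.sqrt_sq (norm_nonneg _)]

/-- A classical `C²` function in `L²(ℝ)`, with derivatives in `L²(ℝ)`, belongs to `H²(ℝ)`. -/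
theorem mem_H2_of_hasDerivAt {u u' u'' : ℝ → ℂ} (h1 : ∀ x, HasDerivAt u (u' x) x)
    (h2 : ∀ x, HasDerivAt u' (u'' x) x) (hu : MemLp u 2 volume) (hu' : MemLp u' 2 volume)
    (hu'' : MemLp u'' 2 volume) :
    ∃ h : hu.toLp u ∈ H2, secondDeriv ⟨hu.toLp u, h⟩ = hu''.toLp u'' := by
  have key : Δ (Lp.toTemperedDistributionCLM ℂ volume 2 (hu.toLp u)) =
      Lp.toTemperedDistributionCLM ℂ volume 2 (hu''.toLp u'') := by
    ext g
    rw [laplacian_apply_apply, Lp.toTemperedDistributionCLM_apply, Lp.toTemperedDistributionCLM_apply,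
      Lp.toTemperedDistribution_apply, Lp.toTemperedDistribution_apply]
    have hΔ : ∀ x, (Δ g) x = SchwartzMap.derivCLM ℂ ℂ (SchwartzMap.derivCLM ℂ ℂ g) x := by
      intro x
      rw [SchwartzMap.laplacian_apply, InnerProductSpace.laplacian_eq_iteratedDeriv_real,
        iteratedDeriv_succ, iteratedDeriv_one]
      rfl
    have hd : ∀ (f : 𝓢(ℝ, ℂ)) x, HasDerivAt f (SchwartzMap.derivCLM ℂ ℂ f x) x :=
      fun f x => f.hasDerivAt x
    have hint : ∀ (f : 𝓢(ℝ, ℂ)) {q : ℝ → ℂ}, MemLp q 2 volume → Integrable (q * ⇑f) volume :=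
      fun f q hq => hq.integrable_mul (f.memLp 2)
    -- Two integrations by parts move both derivatives off the Schwartz function; integrability of
    -- the products removes the boundary terms.
    have e1 := integral_mul_deriv_eq_deriv_mul_of_integrable (fun x _ => h1 x)
      (fun x _ => hd (SchwartzMap.derivCLM ℂ ℂ g) x) (hint _ hu) (hint _ hu') (hint _ hu)
    have e2 := integral_mul_deriv_eq_deriv_mul_of_integrable (fun x _ => h2 x)
      (fun x _ => hd g x) (hint _ hu') (hint _ hu'') (hint _ hu')
    calc ∫ x, (Δ g) x • (hu.toLp u) x
        = ∫ x, u x * SchwartzMap.derivCLM ℂ ℂ (SchwartzMap.derivCLM ℂ ℂ g) x := by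
          apply integral_congr_ae
          filter_upwards [hu.coeFn_toLp] with x hx
          rw [hx, hΔ, smul_eq_mul, mul_comm]
      _ = ∫ x, u'' x * g x := by rw [e1, e2, neg_neg]
      _ = ∫ x, g x • (hu''.toLp u'') x := by
          apply integral_congr_ae
          filter_upwards [hu''.coeFn_toLp] with x hx
          rw [hx, smul_eq_mul, mul_comm]
  have hmem : hu.toLp u ∈ H2 := by
    refine ⟨hu.toLp u - (laplacianScale : ℂ) • hu''.toLp u'', ?_⟩
    rw [besselPotential_two_eq, key, ← Lp.toTemperedDistributionCLM_apply, map_sub, map_smul]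
  refine ⟨hmem, toTemperedDistributionCLM_injective ?_⟩
  rw [secondDeriv_spec, key]

end Sobolev

/-! ### Abstract criterion locating the essential spectrum -/

section Spectral

open scoped InnerProductSpace
open Filter Topology

section SelfAdjoint

variable {E : Type*} [NormedAddCommGroup E] [InnerProductSpace ℂ E] [CompleteSpace E]
  {T : E →ₗ.[ℂ] E}

theorem inner_apply_of_isSelfAdjoint (hT : IsSelfAdjoint T) (u v : T.domain) :
    ⟪T u, (v : E)⟫_ℂ = ⟪(u : E), T v⟫_ℂ := by
  have h := LinearPMap.adjoint_isFormalAdjoint hT.dense_domain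
  rw [LinearPMap.isSelfAdjoint_def.1 hT] at h
  exact h u v

/-- The hypothesis says that v is in the domain of the adjoint, with value g, and the adjoint is T.
-/
theorem exists_apply_eq_of_isSelfAdjoint (hT : IsSelfAdjoint T) {v g : E}
    (h : ∀ u : T.domain, ⟪T u, v⟫_ℂ = ⟪(u : E), g⟫_ℂ) :
    ∃ hv : v ∈ T.domain, T ⟨v, hv⟩ = g := by
  have h' : ∀ u : T.domain, ⟪g, (u : E)⟫_ℂ = ⟪v, T u⟫_ℂ := fun u => by
    rw [← inner_conj_symm, ← h, inner_conj_symm]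
  have hmem : v ∈ T.adjoint.domain := LinearPMap.mem_adjoint_domain_of_exists _ ⟨g, h'⟩
  have happ := LinearPMap.adjoint_apply_eq hT.dense_domain ⟨v, hmem⟩ h'
  have hT' := LinearPMap.isSelfAdjoint_def.1 hT
  have hle : T.adjoint ≤ T := hT'.le
  refine ⟨hle.1 hmem, ?_⟩
  rw [← happ]
  exact (hle.2 rfl).symm

/-- The graph is closed: the symmetry relation passes to the limit and puts v in the domain of the
adjoint. -/
theorem exists_apply_eq_of_tendsto (hT : IsSelfAdjoint T) {u : ℕ → T.domain} {v g : E}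
    (hu : Tendsto (fun n => (u n : E)) atTop (𝓝 v)) (hg : Tendsto (fun n => T (u n)) atTop (𝓝 g)) :
    ∃ hv : v ∈ T.domain, T ⟨v, hv⟩ = g := by
  refine exists_apply_eq_of_isSelfAdjoint hT fun x => ?_
  refine tendsto_nhds_unique (f := fun n => ⟪T x, (u n : E)⟫_ℂ) (l := atTop)
    (tendsto_const_nhds.inner hu) ?_
  simp_rw [inner_apply_of_isSelfAdjoint hT]
  exact tendsto_const_nhds.inner hg

/-- A self-adjoint operator has `z` in its resolvent set as soon as `T - z` and `T - z̄` are bounded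
below. -/
theorem mem_resolventSet_of_bounded_below (hT : IsSelfAdjoint T) {z : ℂ} {δ : ℝ} (hδ : 0 < δ)
    (h1 : ∀ u : T.domain, δ * ‖(u : E)‖ ≤ ‖T u - z • (u : E)‖)
    (h2 : ∀ u : T.domain, T u = (starRingEnd ℂ) z • (u : E) → (u : E) = 0) :
    z ∈ resolventSet T := by
  let A : T.domain →ₗ[ℂ] E := T.toFun - z • T.domain.subtype
  have hA : ∀ u, A u = T u - z • (u : E) := fun u => rfl
  have hinj : Function.Injective A := by
    rw [← LinearMap.ker_eq_bot, LinearMap.ker_eq_bot']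
    intro u hu
    have h := h1 u
    rw [← hA, hu, norm_zero] at h
    exact Subtype.ext (norm_le_zero_iff.1 (nonpos_of_mul_nonpos_right h hδ))
  have hclosed : IsClosed (LinearMap.range A : Set E) := by
    refine isClosed_of_closure_subset fun g hg => ?_
    obtain ⟨y, hy, hlim⟩ := mem_closure_iff_seq_limit.1 hg
    choose u hu using hy
    have hcau : CauchySeq fun n => (u n : E) := by
      rw [Metric.cauchySeq_iff]
      intro ε hε
      obtain ⟨N, hN⟩ := Metric.cauchySeq_iff.1 hlim.cauchySeq (δ * ε) (by positivity)
      refine ⟨N, fun m hm n hn => ?_⟩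
      have h := h1 (u m - u n)
      rw [← hA, map_sub, hu, hu, ← dist_eq_norm] at h
      have h' := h.trans_lt (hN m hm n hn)
      rw [dist_eq_norm]
      exact lt_of_mul_lt_mul_left h' hδ.le
    obtain ⟨v, hv⟩ := cauchySeq_tendsto_of_complete hcau
    have hTu : Tendsto (fun n => T (u n)) atTop (𝓝 (g + z • v)) := by
      refine (hlim.add (hv.const_smul z)).congr fun n => ?_
      rw [← hu, hA, sub_add_cancel]
    obtain ⟨hv', hTv⟩ := exists_apply_eq_of_tendsto hT hv hTu
    refine ⟨⟨v, hv'⟩, ?_⟩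
    rw [hA, hTv, add_sub_cancel_right]
  -- The range is closed, and a vector orthogonal to it is an eigenvector for z̄ or zero; `h2`
  -- excludes the former.
  have hsurj : LinearMap.range A = ⊤ := by
    have : CompleteSpace (LinearMap.range A) := hclosed.completeSpace_coe
    rw [← Submodule.orthogonal_eq_bot_iff, Submodule.eq_bot_iff]
    intro v hv
    have h : ∀ u : T.domain, ⟪T u, v⟫_ℂ = ⟪(u : E), (starRingEnd ℂ) z • v⟫_ℂ := fun u => by
      have h := Submodule.inner_right_of_mem_orthogonal (LinearMap.mem_range_self A u) hv
      rw [hA, inner_sub_left, sub_eq_zero, inner_smul_left] at h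
      rw [h, inner_smul_right]
    obtain ⟨hv', hTv⟩ := exists_apply_eq_of_isSelfAdjoint hT h
    exact h2 ⟨v, hv'⟩ hTv
  let e : T.domain ≃ₗ[ℂ] E := LinearEquiv.ofBijective A ⟨hinj, LinearMap.range_eq_top.1 hsurj⟩
  have he : ∀ x, T (e.symm x) - z • (e.symm x : E) = x := fun x => by
    rw [← hA]; exact e.apply_symm_apply x
  refine ⟨(T.domain.subtype ∘ₗ e.symm.toLinearMap).mkContinuous δ⁻¹ fun x => ?_, fun x => ?_,
    fun u => ?_⟩
  · have h := h1 (e.symm x)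
    rw [he] at h
    rw [inv_mul_eq_div, le_div_iff₀ hδ, mul_comm]
    exact h
  · exact ⟨(e.symm x).2, he x⟩
  · exact congrArg Subtype.val (e.symm_apply_apply u)

theorem im_inner_apply_self (hT : IsSelfAdjoint T) (u : T.domain) :
    (⟪(u : E), T u⟫_ℂ).im = 0 := by
  rw [← Complex.conj_eq_iff_im, inner_conj_symm, inner_apply_of_isSelfAdjoint hT]

/-- As ⟪u, Tu⟫ is real, ⟪u, (T - z)u⟫ has imaginary part -Im z ‖u‖²; Cauchy–Schwarz concludes. -/
theorem im_mul_norm_le (hT : IsSelfAdjoint T) (z : ℂ) (u : T.domain) :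
    |z.im| * ‖(u : E)‖ ≤ ‖T u - z • (u : E)‖ := by
  have h1 : (⟪(u : E), T u - z • (u : E)⟫_ℂ).im = -z.im * ‖(u : E)‖ ^ 2 := by
    rw [inner_sub_right, inner_smul_right, inner_self_eq_norm_sq_to_K, Complex.sub_im,
      im_inner_apply_self hT]
    simp [← Complex.ofReal_pow]
  have h2 : |z.im| * ‖(u : E)‖ ^ 2 ≤ ‖(u : E)‖ * ‖T u - z • (u : E)‖ := by
    have h := (Complex.abs_im_le_norm _).trans (norm_inner_le_norm (𝕜 := ℂ) (u : E) (T u - z • (u : E)))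
    rwa [h1, abs_mul, abs_neg, abs_of_nonneg (sq_nonneg ‖(u : E)‖)] at h
  rcases (norm_nonneg (u : E)).eq_or_lt with h | h
  · rw [← h, mul_zero]; exact norm_nonneg _
  · nlinarith

theorem mem_resolventSet_of_im_ne_zero (hT : IsSelfAdjoint T) {z : ℂ} (hz : z.im ≠ 0) :
    z ∈ resolventSet T := by
  refine mem_resolventSet_of_bounded_below hT (abs_pos.2 hz) (im_mul_norm_le hT z) fun u hu => ?_
  have h := im_mul_norm_le hT ((starRingEnd ℂ) z) u
  rw [hu, sub_self, norm_zero, Complex.conj_im, abs_neg] at h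
  exact norm_le_zero_iff.1 (nonpos_of_mul_nonpos_right h (abs_pos.2 hz))

/-- Approximate eigenvectors of `T` at `z` are relatively compact. -/
def IsWeylCompact (T : E →ₗ.[ℂ] E) (z : ℂ) : Prop :=
  ∀ u : ℕ → T.domain, (∀ n, ‖(u n : E)‖ ≤ 1) →
    Tendsto (fun n => T (u n) - z • (u n : E)) atTop (𝓝 0) →
    ∃ (v : E) (s : ℕ → ℕ), StrictMono s ∧ Tendsto (fun n => (u (s n) : E)) atTop (𝓝 v)

omit [CompleteSpace E] in
theorem mem_eigenspace_iff {z : ℂ} {u : T.domain} :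
    u ∈ eigenspace T z ↔ T u = z • (u : E) := by
  rw [eigenspace, LinearMap.mem_ker, LinearMap.sub_apply, sub_eq_zero]
  rfl

/-- Riesz's theorem: eigenvectors are approximate eigenvectors, so the closed unit ball of the
eigenspace is compact. -/
theorem finiteDimensional_eigenspace (hT : IsSelfAdjoint T) {z : ℂ} (hc : IsWeylCompact T z) :
    FiniteDimensional ℂ (eigenspace T z) := by
  refine FiniteDimensional.of_isCompact_closedBall₀ ℂ (r := 1) one_pos ?_
  rw [isCompact_iff_isSeqCompact]
  intro x hx
  have hTx : ∀ n, T (x n : T.domain) = z • ((x n : T.domain) : E) := fun n =>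
    mem_eigenspace_iff.1 (x n).2
  obtain ⟨v, s, hs, hv⟩ := hc (fun n => x n) (fun n => mem_closedBall_zero_iff.1 (hx n)) (by
    simp_rw [hTx, sub_self]; exact tendsto_const_nhds)
  have hTv : Tendsto (fun n => T (x (s n) : T.domain)) atTop (𝓝 (z • v)) := by
    simp_rw [hTx]; exact hv.const_smul z
  obtain ⟨hv', hTv'⟩ := exists_apply_eq_of_tendsto hT hv hTv
  have hlim : Tendsto (x ∘ s) atTop (𝓝 (⟨⟨v, hv'⟩, mem_eigenspace_iff.2 hTv'⟩ : eigenspace T z)) :=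
    tendsto_subtype_rng.2 (tendsto_subtype_rng.2 hv)
  exact ⟨_, Metric.isClosed_closedBall.mem_of_tendsto hlim (.of_forall fun n => hx _), s, hs, hlim⟩

/-- Otherwise normalized approximate eigenvectors orthogonal to the eigenspace would subconverge to
a unit eigenvector orthogonal to itself. -/
theorem exists_bounded_below (hT : IsSelfAdjoint T) {z : ℂ} (hc : IsWeylCompact T z) :
    ∃ δ > 0, ∀ u : T.domain, (∀ v ∈ eigenspace T z, ⟪((v : T.domain) : E), (u : E)⟫_ℂ = 0) →
      δ * ‖(u : E)‖ ≤ ‖T u - z • (u : E)‖ := by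
  by_contra! hcon
  have hn : ∀ n : ℕ, (0 : ℝ) < 1 / (n + 1) := fun n => by positivity
  choose w hw hlt using fun n : ℕ => hcon _ (hn n)
  have hpos : ∀ n, 0 < ‖(w n : E)‖ := fun n => by
    by_contra! h
    have h0 : (w n : E) = 0 := norm_le_zero_iff.1 h
    have h1 := hlt n
    rw [h0, norm_zero, mul_zero] at h1
    exact absurd h1 (norm_nonneg _).not_gt
  let u : ℕ → T.domain := fun n => ((‖(w n : E)‖⁻¹ : ℝ) : ℂ) • w n
  have hu1 : ∀ n, ‖(u n : E)‖ = 1 := fun n => by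
    rw [Submodule.coe_smul, norm_smul, Complex.norm_real, norm_inv, norm_norm,
      inv_mul_cancel₀ (hpos n).ne']
  have hTu : ∀ n, T (u n) - z • (u n : E) =
      ((‖(w n : E)‖⁻¹ : ℝ) : ℂ) • (T (w n) - z • (w n : E)) := fun n => by
    rw [Submodule.coe_smul, LinearPMap.map_smul, smul_comm, smul_sub]
  have hlim : Tendsto (fun n => T (u n) - z • (u n : E)) atTop (𝓝 0) := by
    refine squeeze_zero_norm (fun n => ?_) tendsto_one_div_add_atTop_nhds_zero_nat
    rw [hTu, norm_smul, Complex.norm_real, norm_inv, norm_norm, inv_mul_le_iff₀ (hpos n), mul_comm]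
    exact (hlt n).le
  obtain ⟨v, s, hs, hv⟩ := hc u (fun n => (hu1 n).le) hlim
  have hTv : Tendsto (fun n => T (u (s n))) atTop (𝓝 (z • v)) := by
    have h := (hlim.comp hs.tendsto_atTop).add (hv.const_smul z)
    rw [zero_add] at h
    exact h.congr fun n => sub_add_cancel _ _
  obtain ⟨hv', hTv'⟩ := exists_apply_eq_of_tendsto hT hv hTv
  have hmem : (⟨v, hv'⟩ : T.domain) ∈ eigenspace T z := mem_eigenspace_iff.2 hTv'
  have h0 : ⟪v, v⟫_ℂ = 0 := by
    refine tendsto_nhds_unique (f := fun n => ⟪v, (u (s n) : E)⟫_ℂ) (l := atTop)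
      (tendsto_const_nhds.inner hv) ?_
    have : ∀ n, ⟪v, (u (s n) : E)⟫_ℂ = 0 := fun n => by
      rw [Submodule.coe_smul, inner_smul_right, hw _ ⟨v, hv'⟩ hmem, mul_zero]
    simp_rw [this]
    exact tendsto_const_nhds
  have h1 : ‖v‖ = 1 := tendsto_nhds_unique hv.norm (by simp_rw [hu1]; exact tendsto_const_nhds)
  rw [inner_self_eq_zero.1 h0, norm_zero] at h1
  exact zero_ne_one h1

/-- Split u = p + q with p in the eigenspace and q orthogonal to it. T - z' multiplies p by z - z',
is bounded below on q by δ - |z' - z|, and the two images are orthogonal; so z' ≠ z within δ of z is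
in the resolvent set. -/
theorem exists_isolated (hT : IsSelfAdjoint T) {z : ℂ} (hc : IsWeylCompact T z) :
    ∃ ε > 0, ∀ z' ∈ spectrum T, z' ≠ z → ε ≤ ‖z' - z‖ := by
  obtain ⟨δ, hδ, hbd⟩ := exists_bounded_below hT hc
  refine ⟨δ, hδ, fun z' hz' hne => ?_⟩
  by_contra! hlt
  have him : z'.im = 0 := by
    by_contra h
    exact hz' (mem_resolventSet_of_im_ne_zero hT h)
  have hconj : (starRingEnd ℂ) z' = z' := Complex.conj_eq_iff_im.2 him
  have hd1 : 0 < ‖z' - z‖ := norm_pos_iff.2 (sub_ne_zero.2 hne)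
  obtain ⟨d, hd, hdz, hdδ⟩ : ∃ d > 0, d ≤ ‖z' - z‖ ∧ d ≤ δ - ‖z' - z‖ :=
    ⟨min ‖z' - z‖ (δ - ‖z' - z‖), lt_min hd1 (by linarith), min_le_left _ _, min_le_right _ _⟩
  have hfin := finiteDimensional_eigenspace hT hc
  let N : Submodule ℂ E := (eigenspace T z).map T.domain.subtype
  have hbelow : ∀ u : T.domain, d * ‖(u : E)‖ ≤ ‖T u - z' • (u : E)‖ := by
    intro u
    obtain ⟨p, hp, hpN⟩ : N.starProjection (u : E) ∈ N := Submodule.starProjection_apply_mem N _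
    have hpE : (p : E) = N.starProjection (u : E) := hpN
    have hTp : T p = z • (p : E) := mem_eigenspace_iff.1 hp
    obtain ⟨q, rfl⟩ : ∃ q, u = p + q := ⟨u - p, by abel⟩
    have hq : ∀ v ∈ eigenspace T z, ⟪((v : T.domain) : E), (q : E)⟫_ℂ = 0 := by
      intro v hv
      have h := Submodule.sub_starProjection_mem_orthogonal (K := N) ((p + q : T.domain) : E)
      rw [← hpE, Submodule.coe_add, add_sub_cancel_left] at h
      exact Submodule.inner_right_of_mem_orthogonal (Submodule.mem_map_of_mem hv) h
    have hpq := hq p hp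
    have horth : ⟪(z - z') • (p : E), T q - z' • (q : E)⟫_ℂ = 0 := by
      rw [inner_smul_left, inner_sub_right, ← inner_apply_of_isSelfAdjoint hT, hTp, inner_smul_left,
        inner_smul_right, hpq, mul_zero, mul_zero, sub_zero, mul_zero]
    have hsum : T (p + q) - z' • ((p + q : T.domain) : E) =
        (z - z') • (p : E) + (T q - z' • (q : E)) := by
      rw [LinearPMap.map_add, hTp, Submodule.coe_add, smul_add, sub_smul]
      abel
    have h1 := norm_add_sq_eq_norm_sq_add_norm_sq_of_inner_eq_zero _ _ horth
    have h2 := norm_add_sq_eq_norm_sq_add_norm_sq_of_inner_eq_zero _ _ hpq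
    have h3 : d * ‖(p : E)‖ ≤ ‖(z - z') • (p : E)‖ := by
      rw [norm_smul, norm_sub_rev]
      gcongr
    have h4 : d * ‖(q : E)‖ ≤ ‖T q - z' • (q : E)‖ := by
      have e : T q - z' • (q : E) = (T q - z • (q : E)) - (z' - z) • (q : E) := by
        rw [sub_smul]; abel
      have h5 := norm_sub_norm_le (T q - z • (q : E)) ((z' - z) • (q : E))
      rw [← e, norm_smul] at h5
      have h6 := hbd q hq
      have h7 := mul_le_mul_of_nonneg_right hdδ (norm_nonneg (q : E))
      linarith
    rw [hsum]
    refine le_of_sq_le_sq ?_ (norm_nonneg _)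
    rw [Submodule.coe_add, mul_pow, sq ‖_ + _‖, sq ‖_ + _‖, h1, h2]
    have h5 := mul_self_le_mul_self (by positivity) h3
    have h6 := mul_self_le_mul_self (by positivity) h4
    nlinarith
  refine hz' (mem_resolventSet_of_bounded_below hT hd hbelow fun u hu => ?_)
  have h := hbelow u
  rw [hu, hconj, sub_self, norm_zero] at h
  exact norm_le_zero_iff.1 (nonpos_of_mul_nonpos_right h hd)

/-- At a real t < κ, a trivial eigenspace makes T - t bounded below on the whole domain, so t is in
the resolvent set; otherwise t is an isolated eigenvalue of finite multiplicity. -/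
theorem essentialSpectrum_subset_Ici (hT : IsSelfAdjoint T) {κ : ℝ}
    (hc : ∀ t : ℝ, t < κ → IsWeylCompact T t) :
    essentialSpectrum T ⊆ Complex.ofReal '' Set.Ici κ := by
  rintro z ⟨hz, hzd⟩
  have him : z.im = 0 := by
    by_contra h
    exact hz (mem_resolventSet_of_im_ne_zero hT h)
  obtain ⟨t, rfl⟩ : ∃ t : ℝ, (t : ℂ) = z := ⟨z.re, Complex.ext rfl him.symm⟩
  refine ⟨t, ?_, rfl⟩
  by_contra ht
  have hW := hc t (not_le.1 ht)
  refine hzd ⟨hz, exists_isolated hT hW, fun hbot => ?_, finiteDimensional_eigenspace hT hW⟩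
  obtain ⟨δ, hδ, hbd⟩ := exists_bounded_below hT hW
  refine hz (mem_resolventSet_of_bounded_below hT hδ (fun u => hbd u fun v hv => ?_) fun u hu => ?_)
  · rw [hbot, Submodule.mem_bot] at hv
    rw [hv, Submodule.coe_zero, inner_zero_left]
  · rw [Complex.conj_ofReal, ← mem_eigenspace_iff, hbot, Submodule.mem_bot] at hu
    rw [hu, Submodule.coe_zero]

end SelfAdjoint

end Spectral

/-! ### Coercivity, ellipticity and self-adjointness of L -/

section Linearized

open scoped InnerProductSpace
open Filter Topology

/-- A positive definite real quadratic form in two variables is bounded below. -/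
theorem exists_quadratic_lower_bound {α β γ : ℝ} (hα : 0 < α) (hdet : β ^ 2 < α * γ) :
    ∃ δ > 0, ∀ x y : ℝ, δ * (x ^ 2 + y ^ 2) ≤ α * x ^ 2 - 2 * β * (x * y) + γ * y ^ 2 := by
  have hγ : 0 < γ := pos_of_mul_pos_right ((sq_nonneg β).trans_lt hdet) hα.le
  have htr : 0 < α + γ := by positivity
  -- Determinant over trace bounds the smaller eigenvalue of the form from below.
  refine ⟨(α * γ - β ^ 2) / (α + γ), div_pos (by linarith) htr, fun x y => ?_⟩
  rw [div_mul_eq_mul_div, div_le_iff₀ htr]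
  nlinarith [sq_nonneg (α * x - β * y), sq_nonneg (γ * y - β * x)]

/-- Bound the right side by max(x, y)(f + g) and divide by the maximum. -/
theorem le_of_quadratic_le {δ x y f g : ℝ} (hδ : 0 < δ) (hx : 0 ≤ x) (hy : 0 ≤ y) (hf : 0 ≤ f)
    (hg : 0 ≤ g) (h : δ * (x ^ 2 + y ^ 2) ≤ x * f + y * g) :
    δ * x ≤ f + g ∧ δ * y ≤ f + g := by
  have key : ∀ {x y f g : ℝ}, 0 ≤ x → x ≤ y → 0 ≤ f → 0 ≤ g →
      δ * (x ^ 2 + y ^ 2) ≤ x * f + y * g → δ * y ≤ f + g := by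
    intro x y f g hx hxy hf hg h
    rcases (hx.trans hxy).eq_or_lt with h0 | h0
    · rw [← h0, mul_zero]; positivity
    · refine le_of_mul_le_mul_right (a := y) ?_ h0
      nlinarith [mul_le_mul_of_nonneg_right hxy hf, mul_nonneg hδ.le (sq_nonneg x)]
  rcases le_total x y with hxy | hxy
  · have h1 := key hx hxy hf hg h
    exact ⟨(mul_le_mul_of_nonneg_left hxy hδ.le).trans h1, h1⟩
  · have h1 := key hy hxy hg hf (by linarith)
    rw [add_comm] at h1
    exact ⟨h1, (mul_le_mul_of_nonneg_left hxy hδ.le).trans h1⟩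

theorem mulPotential_coeFn (φ : C₀(ℝ, ℝ)) (u : L2) :
    (mulPotential φ u : ℝ → ℂ) =ᵐ[volume] fun x => (φ x : ℂ) * u x :=
  (memLp_mul φ u).coeFn_toLp

theorem inner_mulPotential (φ : C₀(ℝ, ℝ)) (u v : L2) :
    ⟪mulPotential φ u, v⟫_ℂ = ⟪u, mulPotential φ v⟫_ℂ := by
  rw [L2.inner_def, L2.inner_def]
  apply integral_congr_ae
  filter_upwards [mulPotential_coeFn φ u, mulPotential_coeFn φ v] with x hu hv
  rw [hu, hv]
  simp only [RCLike.inner_apply, map_mul, Complex.conj_ofReal]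
  ring

theorem norm_mulPotential_le (φ : C₀(ℝ, ℝ)) (u : L2) : ‖mulPotential φ u‖ ≤ ‖φ.toBCF‖ * ‖u‖ := by
  refine Lp.norm_le_mul_norm_of_ae_le_mul ?_
  filter_upwards [mulPotential_coeFn φ u] with x hx
  rw [hx, norm_mul, Complex.norm_real]
  exact mul_le_mul_of_nonneg_right (φ.toBCF.norm_coe_le_norm x) (norm_nonneg _)

theorem re_inner_secondDeriv_comm (u v : H2) :
    (⟪(v : L2), secondDeriv u⟫_ℂ).re = (⟪(u : L2), secondDeriv v⟫_ℂ).re := by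
  rw [← inner_secondDeriv, ← inner_conj_symm, Complex.conj_re]

/-- Completing the square: α times the form is ∂ₓ² tested on αu + βv, plus (αγ - β²) times ∂ₓ²
tested on v. -/
theorem secondDeriv_form_nonpos {α β γ : ℝ} (hα : 0 < α) (hdet : β ^ 2 ≤ α * γ) (u v : H2) :
    α * (⟪(u : L2), secondDeriv u⟫_ℂ).re + 2 * β * (⟪(u : L2), secondDeriv v⟫_ℂ).re +
      γ * (⟪(v : L2), secondDeriv v⟫_ℂ).re ≤ 0 := by
  have hneg : ∀ z : H2, (⟪(z : L2), secondDeriv z⟫_ℂ).re ≤ 0 := fun z => by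
    rw [← inner_secondDeriv]; exact re_inner_secondDeriv_nonpos z
  have h1 := hneg ((α : ℂ) • u + (β : ℂ) • v)
  rw [Submodule.coe_add, Submodule.coe_smul, Submodule.coe_smul, map_add, map_smul, map_smul] at h1
  simp only [inner_add_left, inner_add_right, inner_smul_left, inner_smul_right,
    Complex.conj_ofReal, Complex.add_re, Complex.re_ofReal_mul] at h1
  rw [re_inner_secondDeriv_comm u v] at h1
  have h2 := hneg v
  refine nonpos_of_mul_nonpos_right (a := α) ?_ hα
  nlinarith

/-- The first component of the constant coefficient part of `linearizedOperator`. -/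
def freeFst (b c w : ℝ) (u v : H2) : L2 :=
  (u : L2) + (c : ℂ) • secondDeriv u + (((b * w : ℝ) : ℂ) • secondDeriv v - (w : ℂ) • (v : L2))

theorem freeFst_sub (b c w : ℝ) (u v u' v' : H2) :
    freeFst b c w (u - u') (v - v') = freeFst b c w u v - freeFst b c w u' v' := by
  simp only [freeFst, map_sub, Submodule.coe_sub, smul_sub]
  abel

/-- The constant coefficient part of `linearizedOperator` is coercive. -/
theorem le_re_inner_free {a b c w : ℝ} (hc : c < 0)
    (hdet : (b * w) ^ 2 < a * c) (u v : H2) :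
    (1 - |w|) * (‖(u : L2)‖ ^ 2 + ‖(v : L2)‖ ^ 2) ≤
      (⟪(u : L2), freeFst b c w u v⟫_ℂ).re + (⟪(v : L2), freeFst b a w v u⟫_ℂ).re := by
  -- The second-order part contributes a nonnegative amount; the bound 1 - |w| comes from the
  -- zeroth-order part alone. Swapping a with c and u with v turns the first component into the
  -- second.
  have h1 := secondDeriv_form_nonpos (α := -c) (β := -(b * w)) (γ := -a) (by linarith)
    (by nlinarith) u v
  have h2 := re_inner_secondDeriv_comm u v
  have hself : ∀ z : L2, (⟪z, z⟫_ℂ).re = ‖z‖ ^ 2 := fun z => inner_self_eq_norm_sq (𝕜 := ℂ) z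
  have hsymm : (⟪(v : L2), (u : L2)⟫_ℂ).re = (⟪(u : L2), (v : L2)⟫_ℂ).re := by
    rw [← inner_conj_symm, Complex.conj_re]
  have h3 : |w * (⟪(u : L2), (v : L2)⟫_ℂ).re| ≤ |w| * (‖(u : L2)‖ * ‖(v : L2)‖) := by
    rw [abs_mul]
    exact mul_le_mul_of_nonneg_left ((Complex.abs_re_le_norm _).trans (norm_inner_le_norm _ _))
      (abs_nonneg w)
  have h4 := (abs_le.1 h3).2
  have h5 : |w| * (2 * (‖(u : L2)‖ * ‖(v : L2)‖)) ≤ |w| * (‖(u : L2)‖ ^ 2 + ‖(v : L2)‖ ^ 2) :=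
    mul_le_mul_of_nonneg_left (by nlinarith [sq_nonneg (‖(u : L2)‖ - ‖(v : L2)‖)]) (abs_nonneg w)
  simp only [freeFst, inner_add_right, inner_sub_right, inner_smul_right, Complex.add_re,
    Complex.sub_re, Complex.re_ofReal_mul, hself, hsymm, h2]
  linarith

/-- Elliptic regularity for the constant coefficient part of `linearizedOperator`. -/
theorem exists_norm_secondDeriv_le {a b c w : ℝ} (hc : c < 0) (hw : |w| < 1)
    (hdet : (b * w) ^ 2 < a * c) : ∃ δ > 0, ∀ u v : H2,
      δ * ‖secondDeriv u‖ ≤ ‖freeFst b c w u v‖ + ‖freeFst b a w v u‖ ∧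
      δ * ‖secondDeriv v‖ ≤ ‖freeFst b c w u v‖ + ‖freeFst b a w v u‖ := by
  obtain ⟨δ, hδ, hquad⟩ := exists_quadratic_lower_bound (α := -c) (β := |b * w|) (γ := -a)
    (by linarith) (by rw [sq_abs]; linarith)
  refine ⟨δ, hδ, fun u v => ?_⟩
  refine le_of_quadratic_le hδ (norm_nonneg _) (norm_nonneg _) (norm_nonneg _) (norm_nonneg _) ?_
  -- Pairing with (-u'', -v'') makes the second-order part control ‖u''‖² + ‖v''‖², while the
  -- zeroth-order part is nonnegative because |w| < 1.
  have h1 := secondDeriv_form_nonpos (α := 1) (β := -w) (γ := 1) one_pos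
    (by nlinarith [sq_abs w, abs_nonneg w]) u v
  have h2 := re_inner_secondDeriv_comm u v
  have hself : ∀ z : L2, (⟪z, z⟫_ℂ).re = ‖z‖ ^ 2 := fun z => inner_self_eq_norm_sq (𝕜 := ℂ) z
  have hsymm : (⟪secondDeriv v, secondDeriv u⟫_ℂ).re = (⟪secondDeriv u, secondDeriv v⟫_ℂ).re := by
    rw [← inner_conj_symm, Complex.conj_re]
  have h3 : |(b * w) * (⟪secondDeriv u, secondDeriv v⟫_ℂ).re| ≤
      |b * w| * (‖secondDeriv u‖ * ‖secondDeriv v‖) := by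
    rw [abs_mul]
    exact mul_le_mul_of_nonneg_left ((Complex.abs_re_le_norm _).trans (norm_inner_le_norm _ _))
      (abs_nonneg _)
  have h4 := (abs_le.1 h3).2
  have h5 := hquad ‖secondDeriv u‖ ‖secondDeriv v‖
  have h6 : ∀ x y : L2, -(⟪x, y⟫_ℂ).re ≤ ‖x‖ * ‖y‖ := fun x y =>
    (neg_le_abs _).trans ((Complex.abs_re_le_norm _).trans (norm_inner_le_norm _ _))
  have h7 := h6 (secondDeriv u) (freeFst b c w u v)
  have h8 := h6 (secondDeriv v) (freeFst b a w v u)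
  have h9 : -(⟪secondDeriv u, freeFst b c w u v⟫_ℂ).re - (⟪secondDeriv v, freeFst b a w v u⟫_ℂ).re =
      (-c * ‖secondDeriv u‖ ^ 2 - 2 * ((b * w) * (⟪secondDeriv u, secondDeriv v⟫_ℂ).re)
        - a * ‖secondDeriv v‖ ^ 2) - (1 * (⟪(u : L2), secondDeriv u⟫_ℂ).re +
        2 * (-w) * (⟪(u : L2), secondDeriv v⟫_ℂ).re + 1 * (⟪(v : L2), secondDeriv v⟫_ℂ).re) := by
    simp only [freeFst, inner_add_right, inner_sub_right, inner_smul_right, Complex.add_re,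
      Complex.sub_re, Complex.re_ofReal_mul, hself, hsymm, inner_secondDeriv, h2]
    ring
  linarith

section Operator

variable {a b c w : ℝ} {φ ψ : C₀(ℝ, ℝ)}

theorem linearizedOperator_fst (u : (linearizedOperator a b c w φ ψ).domain) :
    (linearizedOperator a b c w φ ψ u).fst =
      freeFst b c w (compFst u) (compSnd u) + mulPotential ψ (compSnd u) := by
  change ((compFst u : L2) + (c : ℂ) • secondDeriv (compFst u)) +
    (((b * w : ℝ) : ℂ) • secondDeriv (compSnd u) + mulPotential ψ (compSnd u) -
      (w : ℂ) • (compSnd u : L2)) = _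
  rw [freeFst]
  abel

theorem linearizedOperator_snd (u : (linearizedOperator a b c w φ ψ).domain) :
    (linearizedOperator a b c w φ ψ u).snd =
      freeFst b a w (compSnd u) (compFst u) + mulPotential ψ (compFst u) +
        mulPotential φ (compSnd u) := by
  change (((b * w : ℝ) : ℂ) • secondDeriv (compFst u) + mulPotential ψ (compFst u) -
      (w : ℂ) • (compFst u : L2)) +
    ((compSnd u : L2) + (a : ℂ) • secondDeriv (compSnd u) + mulPotential φ (compSnd u)) = _
  rw [freeFst]
  abel

theorem dense_H2Pair : Dense (H2Pair : Set L2Pair) :=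
  (dense_H2.prod dense_H2).preimage (WithLp.homeomorphProd 2 L2 L2).isOpenMap

theorem inner_linearizedOperator (u v : (linearizedOperator a b c w φ ψ).domain) :
    ⟪linearizedOperator a b c w φ ψ u, (v : L2Pair)⟫_ℂ =
      ⟪(u : L2Pair), linearizedOperator a b c w φ ψ v⟫_ℂ := by
  have h1 : (u : L2Pair).fst = (compFst u : L2) := rfl
  have h2 : (u : L2Pair).snd = (compSnd u : L2) := rfl
  have h3 : (v : L2Pair).fst = (compFst v : L2) := rfl
  have h4 : (v : L2Pair).snd = (compSnd v : L2) := rfl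
  simp only [WithLp.prod_inner_apply, WithLp.ofLp_fst, WithLp.ofLp_snd, linearizedOperator_fst,
    linearizedOperator_snd, h1, h2, h3, h4, freeFst]
  simp only [inner_add_left, inner_add_right, inner_sub_left, inner_sub_right, inner_smul_left,
    inner_smul_right, Complex.conj_ofReal, inner_secondDeriv, inner_mulPotential]
  ring

theorem exists_domain_pair (u v : H2) : ∃ U : (linearizedOperator a b c w φ ψ).domain,
    (U : L2Pair).fst = (u : L2) ∧ (U : L2Pair).snd = (v : L2) ∧ compFst U = u ∧ compSnd U = v :=
  ⟨⟨WithLp.toLp 2 ((u : L2), (v : L2)), u.2, v.2⟩, rfl, rfl, rfl, rfl⟩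

/-- Testing on (u, 0) and (0, u) puts c y₁ + bw y₂ and bw y₁ + a y₂ in H², the bounded terms being
absorbed in g. The coefficient matrix is invertible. -/
theorem mem_H2Pair_of_adjoint (hdet : (b * w) ^ 2 < a * c) {y g : L2Pair}
    (h : ∀ u : (linearizedOperator a b c w φ ψ).domain,
      ⟪linearizedOperator a b c w φ ψ u, y⟫_ℂ = ⟪(u : L2Pair), g⟫_ℂ) : y ∈ H2Pair := by
  have hp1 : (c : ℂ) • y.fst + ((b * w : ℝ) : ℂ) • y.snd ∈ H2 := by
    refine mem_H2_of_inner_secondDeriv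
      (g := g.fst - y.fst - mulPotential ψ y.snd + (w : ℂ) • y.snd) fun u => ?_
    obtain ⟨U, e1, e2, e3, e4⟩ :=
      exists_domain_pair (a := a) (b := b) (c := c) (w := w) (φ := φ) (ψ := ψ) u 0
    have h1 := h U
    simp only [WithLp.prod_inner_apply, WithLp.ofLp_fst, WithLp.ofLp_snd, linearizedOperator_fst,
      linearizedOperator_snd, e1, e2, e3, e4, freeFst, map_zero, Submodule.coe_zero, smul_zero,
      add_zero, sub_zero, zero_add, inner_zero_left] at h1
    simp only [inner_add_left, inner_add_right, inner_sub_left, inner_sub_right, inner_smul_left,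
      inner_smul_right, Complex.conj_ofReal, inner_mulPotential] at h1 ⊢
    linear_combination h1
  have hp2 : ((b * w : ℝ) : ℂ) • y.fst + (a : ℂ) • y.snd ∈ H2 := by
    refine mem_H2_of_inner_secondDeriv
      (g := g.snd - y.snd - mulPotential φ y.snd - mulPotential ψ y.fst + (w : ℂ) • y.fst)
      fun u => ?_
    obtain ⟨U, e1, e2, e3, e4⟩ :=
      exists_domain_pair (a := a) (b := b) (c := c) (w := w) (φ := φ) (ψ := ψ) 0 u
    have h1 := h U
    simp only [WithLp.prod_inner_apply, WithLp.ofLp_fst, WithLp.ofLp_snd, linearizedOperator_fst,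
      linearizedOperator_snd, e1, e2, e3, e4, freeFst, map_zero, Submodule.coe_zero, smul_zero,
      add_zero, sub_zero, zero_add, inner_zero_left] at h1
    simp only [inner_add_left, inner_add_right, inner_sub_left, inner_sub_right, inner_smul_left,
      inner_smul_right, Complex.conj_ofReal, inner_mulPotential] at h1 ⊢
    linear_combination h1
  have hd : ((a * c - (b * w) ^ 2 : ℝ) : ℂ) ≠ 0 := Complex.ofReal_ne_zero.2 (by linarith)
  refine ⟨?_, ?_⟩
  · refine (H2.smul_mem_iff hd).1 ?_
    have h1 := H2.sub_mem (H2.smul_mem (a : ℂ) hp1) (H2.smul_mem ((b * w : ℝ) : ℂ) hp2)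
    convert h1 using 1
    change _ • y.fst = _
    push_cast
    module
  · refine (H2.smul_mem_iff hd).1 ?_
    have h1 := H2.sub_mem (H2.smul_mem (c : ℂ) hp2) (H2.smul_mem ((b * w : ℝ) : ℂ) hp1)
    convert h1 using 1
    change _ • y.snd = _
    push_cast
    module

theorem isSelfAdjoint_linearizedOperator (hdet : (b * w) ^ 2 < a * c) :
    IsSelfAdjoint (linearizedOperator a b c w φ ψ) := by
  have hdense : Dense ((linearizedOperator a b c w φ ψ).domain : Set L2Pair) := dense_H2Pair
  rw [LinearPMap.isSelfAdjoint_def]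
  have hle : linearizedOperator a b c w φ ψ ≤ (linearizedOperator a b c w φ ψ).adjoint :=
    LinearPMap.IsFormalAdjoint.le_adjoint hdense inner_linearizedOperator
  refine (LinearPMap.eq_of_le_of_domain_eq hle (le_antisymm hle.1 fun y hy => ?_)).symm
  refine mem_H2Pair_of_adjoint (φ := φ) (ψ := ψ) hdet (g := (linearizedOperator a b c w φ ψ).adjoint ⟨y, hy⟩)
    fun u => ?_
  exact (LinearPMap.adjoint_isFormalAdjoint hdense).symm u ⟨y, hy⟩

end Operator

end Linearized

/-! ### Relative compactness of approximate eigenvectors of L -/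

section Essential

open scoped InnerProductSpace
open Filter Topology

section WeylCompact

variable {a b c w : ℝ} {φ ψ : C₀(ℝ, ℝ)}

/-- Below its lower bound, the constant coefficient operator is bounded below. -/
theorem norm_le_free_sub {t : ℝ} (hc : c < 0) (hdet : (b * w) ^ 2 < a * c) (ht : t < 1 - |w|)
    (u v : H2) :
    (1 - |w| - t) * ‖(u : L2)‖ ≤ ‖freeFst b c w u v - (t : ℂ) • (u : L2)‖ +
        ‖freeFst b a w v u - (t : ℂ) • (v : L2)‖ ∧
      (1 - |w| - t) * ‖(v : L2)‖ ≤ ‖freeFst b c w u v - (t : ℂ) • (u : L2)‖ +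
        ‖freeFst b a w v u - (t : ℂ) • (v : L2)‖ := by
  refine le_of_quadratic_le (by linarith) (norm_nonneg _) (norm_nonneg _) (norm_nonneg _)
    (norm_nonneg _) ?_
  have h1 := le_re_inner_free hc hdet u v
  have h2 : ∀ x y : L2, (⟪x, y⟫_ℂ).re ≤ ‖x‖ * ‖y‖ := fun x y =>
    (Complex.re_le_norm _).trans (norm_inner_le_norm _ _)
  have hself : ∀ z : L2, (⟪z, z⟫_ℂ).re = ‖z‖ ^ 2 := fun z => inner_self_eq_norm_sq (𝕜 := ℂ) z
  have h3 := h2 (u : L2) (freeFst b c w u v - (t : ℂ) • (u : L2))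
  have h4 := h2 (v : L2) (freeFst b a w v u - (t : ℂ) • (v : L2))
  rw [inner_sub_right, inner_smul_right, Complex.sub_re, Complex.re_ofReal_mul, hself] at h3 h4
  linarith

/-- Elliptic regularity bounds the sequence in H², so along a subsequence the potential terms
converge strongly. Then (L₀ - t)u converges as well, and u is Cauchy because L₀ - t is bounded
below. -/
theorem isWeylCompact_linearizedOperator {t : ℝ} (hc : c < 0) (hw : |w| < 1)
    (hdet : (b * w) ^ 2 < a * c) (hφ : MemLp φ 2 volume) (hψ : MemLp ψ 2 volume)
    (ht : t < 1 - |w|) : IsWeylCompact (linearizedOperator a b c w φ ψ) t := by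
  intro u hu hlim
  have hx : ∀ n, ‖(compFst (u n) : L2)‖ ≤ 1 := fun n =>
    (WithLp.norm_fst_le _ (u n : L2Pair)).trans (hu n)
  have hy : ∀ n, ‖(compSnd (u n) : L2)‖ ≤ 1 := fun n =>
    (WithLp.norm_snd_le _ (u n : L2Pair)).trans (hu n)
  set x : ℕ → H2 := fun n => compFst (u n)
  set y : ℕ → H2 := fun n => compSnd (u n)
  have hF : Tendsto (fun n => freeFst b c w (x n) (y n) - (t : ℂ) • (x n : L2) +
      mulPotential ψ (y n)) atTop (𝓝 0) := by
    have h := ((WithLp.prod_continuous_ofLp 2 L2 L2).fst.tendsto 0).comp hlim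
    refine h.congr fun n => ?_
    change (linearizedOperator a b c w φ ψ (u n)).fst - (t : ℂ) • (x n : L2) = _
    rw [linearizedOperator_fst]
    abel
  have hG : Tendsto (fun n => freeFst b a w (y n) (x n) - (t : ℂ) • (y n : L2) +
      (mulPotential ψ (x n) + mulPotential φ (y n))) atTop (𝓝 0) := by
    have h := ((WithLp.prod_continuous_ofLp 2 L2 L2).snd.tendsto 0).comp hlim
    refine h.congr fun n => ?_
    change (linearizedOperator a b c w φ ψ (u n)).snd - (t : ℂ) • (y n : L2) = _
    rw [linearizedOperator_snd]
    abel
  have hV : ∀ (θ : C₀(ℝ, ℝ)) {z : L2}, ‖z‖ ≤ 1 → ‖mulPotential θ z‖ ≤ ‖θ.toBCF‖ := fun θ z hz =>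
    (norm_mulPotential_le θ z).trans (mul_le_of_le_one_right (norm_nonneg _) hz)
  have hT : ∀ {z : L2}, ‖z‖ ≤ 1 → ‖(t : ℂ) • z‖ ≤ |t| := fun {z} hz => by
    rw [norm_smul, Complex.norm_real]
    exact mul_le_of_le_one_right (norm_nonneg _) hz
  obtain ⟨M, hM⟩ := hF.norm.bddAbove_range
  obtain ⟨M', hM'⟩ := hG.norm.bddAbove_range
  have hFb : ∀ n, ‖freeFst b c w (x n) (y n)‖ ≤ M + |t| + ‖ψ.toBCF‖ := fun n => by
    have h : freeFst b c w (x n) (y n) = (freeFst b c w (x n) (y n) - (t : ℂ) • (x n : L2) +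
      mulPotential ψ (y n)) + (t : ℂ) • (x n : L2) - mulPotential ψ (y n) := by abel
    rw [h]
    exact norm_sub_le_of_le (norm_add_le_of_le (hM ⟨n, rfl⟩) (hT (hx n))) (hV ψ (hy n))
  have hGb : ∀ n, ‖freeFst b a w (y n) (x n)‖ ≤ M' + |t| + (‖ψ.toBCF‖ + ‖φ.toBCF‖) := fun n => by
    have h : freeFst b a w (y n) (x n) = (freeFst b a w (y n) (x n) - (t : ℂ) • (y n : L2) +
      (mulPotential ψ (x n) + mulPotential φ (y n))) + (t : ℂ) • (y n : L2) -
      (mulPotential ψ (x n) + mulPotential φ (y n)) := by abel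
    rw [h]
    exact norm_sub_le_of_le (norm_add_le_of_le (hM' ⟨n, rfl⟩) (hT (hy n)))
      (norm_add_le_of_le (hV ψ (hx n)) (hV φ (hy n)))
  obtain ⟨δ, hδ, hreg⟩ := exists_norm_secondDeriv_le hc hw hdet
  obtain ⟨K, hK⟩ : ∃ K, ∀ n, ‖besselOp (x n)‖ ≤ K ∧ ‖besselOp (y n)‖ ≤ K := by
    refine ⟨1 + laplacianScale * ((M + |t| + ‖ψ.toBCF‖ +
      (M' + |t| + (‖ψ.toBCF‖ + ‖φ.toBCF‖))) / δ), fun n => ?_⟩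
    have key : ∀ z : H2, ‖(z : L2)‖ ≤ 1 → δ * ‖secondDeriv z‖ ≤
        ‖freeFst b c w (x n) (y n)‖ + ‖freeFst b a w (y n) (x n)‖ →
        ‖besselOp z‖ ≤ 1 + laplacianScale * ((M + |t| + ‖ψ.toBCF‖ +
      (M' + |t| + (‖ψ.toBCF‖ + ‖φ.toBCF‖))) / δ) := fun z hz hz' => by
      rw [besselOp_apply]
      refine norm_sub_le_of_le hz ?_
      rw [norm_smul, Complex.norm_real, Real.norm_of_nonneg laplacianScale_pos.le]
      refine mul_le_mul_of_nonneg_left ?_ laplacianScale_pos.le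
      rw [le_div_iff₀ hδ, mul_comm]
      exact hz'.trans (add_le_add (hFb n) (hGb n))
    exact ⟨key _ (hx n) (hreg _ _).1, key _ (hy n) (hreg _ _).2⟩
  -- Needed for the separability of L², on which the extraction of weak limits relies.
  have : Fact ((2 : ENNReal) ≠ ⊤) := ⟨by norm_num⟩
  obtain ⟨p, s, hs, hp⟩ := exists_subseq_tendsto_inner (fun n => besselOp (x n)) K fun n => (hK n).1
  obtain ⟨q, r, hr, hq⟩ := exists_subseq_tendsto_inner (fun n => besselOp (y (s n))) K
    fun n => (hK _).2
  have hVx : ∀ θ : C₀(ℝ, ℝ), MemLp θ 2 volume →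
      Tendsto (fun n => mulPotential θ (x (s (r n)))) atTop (𝓝 (mulPotential θ (besselInv p))) := by
    intro θ hθ
    have h := tendsto_mulPotential_besselInv θ hθ (fun n => besselOp (x (s (r n)))) p K
      (fun n => (hK _).1) fun k => (hp k).comp hr.tendsto_atTop
    simpa only [besselInv_besselOp] using h
  have hVy : ∀ θ : C₀(ℝ, ℝ), MemLp θ 2 volume →
      Tendsto (fun n => mulPotential θ (y (s (r n)))) atTop (𝓝 (mulPotential θ (besselInv q))) := by
    intro θ hθ
    have h := tendsto_mulPotential_besselInv θ hθ (fun n => besselOp (y (s (r n)))) q K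
      (fun n => (hK _).2) hq
    simpa only [besselInv_besselOp] using h
  have hsr : StrictMono (s ∘ r) := hs.comp hr
  have hF' := ((hF.comp hsr.tendsto_atTop).sub (hVy ψ hψ)).congr
    (f₂ := fun n => freeFst b c w (x (s (r n))) (y (s (r n))) - (t : ℂ) • (x (s (r n)) : L2))
    fun n => add_sub_cancel_right _ _
  have hG' := ((hG.comp hsr.tendsto_atTop).sub ((hVx ψ hψ).add (hVy φ hφ))).congr
    (f₂ := fun n => freeFst b a w (y (s (r n))) (x (s (r n))) - (t : ℂ) • (y (s (r n)) : L2))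
    fun n => add_sub_cancel_right _ _
  have hκ : 0 < 1 - |w| - t := by linarith
  have hcau : ∀ z : ℕ → H2, (∀ m n, (1 - |w| - t) * ‖(z m : L2) - z n‖ ≤
      ‖(freeFst b c w (x (s (r m))) (y (s (r m))) - (t : ℂ) • (x (s (r m)) : L2)) -
        (freeFst b c w (x (s (r n))) (y (s (r n))) - (t : ℂ) • (x (s (r n)) : L2))‖ +
      ‖(freeFst b a w (y (s (r m))) (x (s (r m))) - (t : ℂ) • (y (s (r m)) : L2)) -
        (freeFst b a w (y (s (r n))) (x (s (r n))) - (t : ℂ) • (y (s (r n)) : L2))‖) →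
      ∃ v : L2, Tendsto (fun n => (z n : L2)) atTop (𝓝 v) := by
    intro z hz
    refine cauchySeq_tendsto_of_complete (Metric.cauchySeq_iff.2 fun ε hε => ?_)
    obtain ⟨N, hN⟩ := Metric.cauchySeq_iff.1 hF'.cauchySeq ((1 - |w| - t) * ε / 2) (by positivity)
    obtain ⟨N', hN'⟩ := Metric.cauchySeq_iff.1 hG'.cauchySeq ((1 - |w| - t) * ε / 2) (by positivity)
    refine ⟨max N N', fun m hm n hn => ?_⟩
    have h1 := hN m (le_of_max_le_left hm) n (le_of_max_le_left hn)
    have h2 := hN' m (le_of_max_le_right hm) n (le_of_max_le_right hn)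
    rw [dist_eq_norm] at h1 h2 ⊢
    have h3 := hz m n
    refine lt_of_mul_lt_mul_left (h3.trans_lt ?_) hκ.le
    linarith
  have hdiff : ∀ (b c : ℝ) (x y x' y' : H2), freeFst b c w (x - x') (y - y') -
      (t : ℂ) • ((x - x' : H2) : L2) = (freeFst b c w x y - (t : ℂ) • (x : L2)) -
        (freeFst b c w x' y' - (t : ℂ) • (x' : L2)) := fun b c x y x' y' => by
    rw [freeFst_sub, Submodule.coe_sub, smul_sub]
    abel
  have hpair := fun m n => norm_le_free_sub (t := t) hc hdet ht (x (s (r m)) - x (s (r n)))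
    (y (s (r m)) - y (s (r n)))
  simp only [hdiff] at hpair
  obtain ⟨v₁, hv₁⟩ := hcau (fun n => x (s (r n))) fun m n => (hpair m n).1
  obtain ⟨v₂, hv₂⟩ := hcau (fun n => y (s (r n))) fun m n => (hpair m n).2
  exact ⟨WithLp.toLp 2 (v₁, v₂), s ∘ r, hsr,
    ((WithLp.prod_continuous_toLp 2 L2 L2).tendsto (v₁, v₂)).comp (hv₁.prodMk_nhds hv₂)⟩

theorem essentialSpectrum_linearizedOperator_subset (hc : c < 0) (hw : |w| < 1)
    (hdet : (b * w) ^ 2 < a * c) (hφ : MemLp φ 2 volume) (hψ : MemLp ψ 2 volume) :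
    essentialSpectrum (linearizedOperator a b c w φ ψ) ⊆ Complex.ofReal '' Set.Ici (1 - |w|) :=
  essentialSpectrum_subset_Ici (isSelfAdjoint_linearizedOperator hdet) fun _ ht =>
    isWeylCompact_linearizedOperator hc hw hdet hφ hψ ht

end WeylCompact

end Essential

/-! ### Square-integrability of the profile and its derivatives -/

section Profile

open Filter Topology

/-- A function that is convex near `+∞` and tends to zero there has an integrable second
derivative. -/
theorem integrableOn_secondDeriv_of_nonneg {f f' f'' : ℝ → ℝ} {R : ℝ}
    (h1 : ∀ x, HasDerivAt f (f' x) x) (h2 : ∀ x, HasDerivAt f' (f'' x) x)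
    (hf : Tendsto f atTop (𝓝 0)) (hpos : ∀ x, R ≤ x → 0 ≤ f'' x) :
    IntegrableOn f'' (Set.Ioi R) := by
  have hmono : MonotoneOn f' (Set.Ici R) := by
    refine monotoneOn_of_deriv_nonneg (convex_Ici R)
      (fun x _ => (h2 x).continuousAt.continuousWithinAt)
      (fun x _ => (h2 x).differentiableAt.differentiableWithinAt) fun x hx => ?_
    rw [(h2 x).deriv]
    exact hpos x (interior_subset hx)
  -- A positive slope at one point would persist by convexity and force linear growth.
  have hneg : ∀ x, R ≤ x → f' x ≤ 0 := by
    intro x₀ hx₀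
    by_contra! hlt
    have hgrow : ∀ x, x₀ ≤ x → f x₀ + f' x₀ * (x - x₀) ≤ f x := by
      intro x hx
      have h := (convex_Ici x₀).mul_sub_le_image_sub_of_le_deriv (f := f) (C := f' x₀)
        (fun x _ => (h1 x).continuousAt.continuousWithinAt)
        (fun x _ => (h1 x).differentiableAt.differentiableWithinAt) (fun y hy => by
          rw [(h1 y).deriv]
          have hy' : x₀ ≤ y := interior_subset hy
          exact hmono hx₀ (hx₀.trans hy') hy') x₀ Set.self_mem_Ici x hx hx
      linarith
    have hlim : Tendsto (fun x => f x₀ + f' x₀ * (x - x₀)) atTop atTop :=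
      tendsto_atTop_add_const_left _ _
        ((tendsto_atTop_add_const_right atTop (-x₀) tendsto_id).const_mul_atTop hlt)
    exact not_tendsto_nhds_of_tendsto_atTop
      (tendsto_atTop_mono' _ ((eventually_ge_atTop x₀).mono hgrow) hlim) 0 hf
  -- Freezing f' to the left of R gives a globally monotone function bounded above, so f' has a
  -- limit at infinity.
  have hmono' : Monotone fun x => f' (max x R) := fun x y hxy =>
    hmono (le_max_right x R) (le_max_right y R) (max_le_max_right R hxy)
  have hlim := tendsto_atTop_ciSup hmono' ⟨0, by
    rintro _ ⟨x, rfl⟩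
    exact hneg _ (le_max_right _ _)⟩
  refine integrableOn_Ioi_deriv_of_nonneg' (fun x _ => h2 x) (fun x hx => hpos x (le_of_lt hx))
    (hlim.congr' ?_)
  filter_upwards [eventually_ge_atTop R] with x hx
  rw [max_eq_left hx]

/-- Solutions of the profile equations that vanish at `+∞` are square-integrable near `+∞`, together
with their first derivatives. -/
theorem integrableAtFilter_atTop_of_profile {α β γ w : ℝ} (hα : 0 < α) (hdet : β ^ 2 < α * γ)
    (hw : |w| < 1) {p p' p'' q q' q'' : ℝ → ℝ}
    (hp : ∀ x, HasDerivAt p (p' x) x) (hp' : ∀ x, HasDerivAt p' (p'' x) x)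
    (hq : ∀ x, HasDerivAt q (q' x) x) (hq' : ∀ x, HasDerivAt q' (q'' x) x)
    (h1 : ∀ x, α * p'' x - β * q'' x = p x - w * q x + q x ^ 2 / 2)
    (h2 : ∀ x, -β * p'' x + γ * q'' x = q x - w * p x + p x * q x)
    (hp0 : Tendsto p atTop (𝓝 0)) (hq0 : Tendsto q atTop (𝓝 0)) :
    IntegrableAtFilter (fun x => p x ^ 2 + q x ^ 2 + p' x ^ 2 + q' x ^ 2) atTop volume := by
  obtain ⟨δ, hδ, hquad⟩ := exists_quadratic_lower_bound hα hdet
  have hw' : 0 < 1 - |w| := by linarith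
  obtain ⟨η, hη, hηδ, hηw⟩ : ∃ η > 0, η ≤ 2 * δ ∧ η ≤ 1 - |w| :=
    ⟨min (2 * δ) (1 - |w|), lt_min (by positivity) hw', min_le_left _ _, min_le_right _ _⟩
  obtain ⟨R, hR⟩ : ∃ R, ∀ x, R ≤ x → -(1 - |w|) / 3 < p x :=
    eventually_atTop.1 (hp0.eventually (lt_mem_nhds (by linarith)))
  let f : ℝ → ℝ := fun x => α * (p x * p x) - 2 * β * (p x * q x) + γ * (q x * q x)
  let f' : ℝ → ℝ := fun x => α * (p' x * p x + p x * p' x) - 2 * β * (p' x * q x + p x * q' x) +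
    γ * (q' x * q x + q x * q' x)
  let f'' : ℝ → ℝ := fun x =>
    α * ((p'' x * p x + p' x * p' x) + (p' x * p' x + p x * p'' x)) -
    2 * β * ((p'' x * q x + p' x * q' x) + (p' x * q' x + p x * q'' x)) +
    γ * ((q'' x * q x + q' x * q' x) + (q' x * q' x + q x * q'' x))
  have hf : ∀ x, HasDerivAt f (f' x) x := fun x =>
    ((((hp x).mul (hp x)).const_mul α).sub (((hp x).mul (hq x)).const_mul (2 * β))).add
      (((hq x).mul (hq x)).const_mul γ)
  have hf' : ∀ x, HasDerivAt f' (f'' x) x := fun x =>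
    (((((hp' x).mul (hp x)).add ((hp x).mul (hp' x))).const_mul α).sub
      ((((hp' x).mul (hq x)).add ((hp x).mul (hq' x))).const_mul (2 * β))).add
      ((((hq' x).mul (hq x)).add ((hq x).mul (hq' x))).const_mul γ)
  have hf0 : Tendsto f atTop (𝓝 0) := by
    have h := (((hp0.mul hp0).const_mul α).sub ((hp0.mul hq0).const_mul (2 * β))).add
      ((hq0.mul hq0).const_mul γ)
    simpa using h
  have hlow : ∀ x, R ≤ x → η * (p x ^ 2 + q x ^ 2 + p' x ^ 2 + q' x ^ 2) ≤ f'' x := by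
    intro x hx
    have hf''x : f'' x = 2 * (α * p' x ^ 2 - 2 * β * (p' x * q' x) + γ * q' x ^ 2) +
        2 * (p x ^ 2 - 2 * (w * (p x * q x)) + q x ^ 2) + 3 * (p x * q x ^ 2) := by
      simp only [f'']
      linear_combination 2 * p x * h1 x + 2 * q x * h2 x
    have e1 := hquad (p' x) (q' x)
    have e2 : 2 * (w * (p x * q x)) ≤ |w| * (p x ^ 2 + q x ^ 2) := by
      have i1 : w * (p x * q x) ≤ |w| * |p x * q x| := by
        rw [← abs_mul]; exact le_abs_self _
      have i2 : 2 * |p x * q x| ≤ p x ^ 2 + q x ^ 2 := by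
        rw [abs_mul]
        nlinarith [sq_nonneg (|p x| - |q x|), sq_abs (p x), sq_abs (q x)]
      nlinarith [abs_nonneg w]
    have e3 : -(1 - |w|) * q x ^ 2 ≤ 3 * (p x * q x ^ 2) := by
      nlinarith [hR x hx, sq_nonneg (q x)]
    have e4 := mul_le_mul_of_nonneg_right hηδ (add_nonneg (sq_nonneg (p' x)) (sq_nonneg (q' x)))
    have e5 := mul_le_mul_of_nonneg_right hηw (add_nonneg (sq_nonneg (p x)) (sq_nonneg (q x)))
    rw [hf''x]
    nlinarith [mul_nonneg hw'.le (sq_nonneg (p x))]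
  have hint := integrableOn_secondDeriv_of_nonneg hf hf' hf0 fun x hx =>
    (by positivity : (0 : ℝ) ≤ η * (p x ^ 2 + q x ^ 2 + p' x ^ 2 + q' x ^ 2)).trans (hlow x hx)
  have hcp : Continuous p := continuous_iff_continuousAt.2 fun x => (hp x).continuousAt
  have hcp' : Continuous p' := continuous_iff_continuousAt.2 fun x => (hp' x).continuousAt
  have hcq : Continuous q := continuous_iff_continuousAt.2 fun x => (hq x).continuousAt
  have hcq' : Continuous q' := continuous_iff_continuousAt.2 fun x => (hq' x).continuousAt
  refine ⟨Set.Ioi R, Ioi_mem_atTop R, (hint.const_mul η⁻¹).mono'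
    (Continuous.aestronglyMeasurable (by fun_prop)) ?_⟩
  filter_upwards [ae_restrict_mem measurableSet_Ioi] with x hx
  rw [Real.norm_of_nonneg (by positivity), inv_mul_eq_div, le_div_iff₀ hη, mul_comm]
  exact hlow x (le_of_lt hx)

/-- The equations contain no odd derivative, so the reflection x ↦ -x reduces -∞ to +∞; continuity
handles bounded intervals. -/
theorem integrable_of_profile {α β γ w : ℝ} (hα : 0 < α) (hdet : β ^ 2 < α * γ)
    (hw : |w| < 1) {p p' p'' q q' q'' : ℝ → ℝ}
    (hp : ∀ x, HasDerivAt p (p' x) x) (hp' : ∀ x, HasDerivAt p' (p'' x) x)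
    (hq : ∀ x, HasDerivAt q (q' x) x) (hq' : ∀ x, HasDerivAt q' (q'' x) x)
    (h1 : ∀ x, α * p'' x - β * q'' x = p x - w * q x + q x ^ 2 / 2)
    (h2 : ∀ x, -β * p'' x + γ * q'' x = q x - w * p x + p x * q x)
    (hp0 : Tendsto p (cocompact ℝ) (𝓝 0)) (hq0 : Tendsto q (cocompact ℝ) (𝓝 0)) :
    Integrable (fun x => p x ^ 2 + q x ^ 2 + p' x ^ 2 + q' x ^ 2) volume := by
  have hcp : Continuous p := continuous_iff_continuousAt.2 fun x => (hp x).continuousAt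
  have hcp' : Continuous p' := continuous_iff_continuousAt.2 fun x => (hp' x).continuousAt
  have hcq : Continuous q := continuous_iff_continuousAt.2 fun x => (hq x).continuousAt
  have hcq' : Continuous q' := continuous_iff_continuousAt.2 fun x => (hq' x).continuousAt
  rw [cocompact_eq_atBot_atTop, tendsto_sup] at hp0 hq0
  refine integrable_iff_integrableAtFilter_atBot_atTop.2 ⟨⟨?_, ?_⟩, Continuous.locallyIntegrable
    (by fun_prop)⟩
  · have hneg : ∀ {r r' : ℝ → ℝ}, (∀ x, HasDerivAt r (r' x) x) →
        ∀ x, HasDerivAt (fun x => r (-x)) (-r' (-x)) x := fun {r r'} hr x => by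
      simpa [Function.comp_def] using! (hr (-x)).scomp x (hasDerivAt_neg x)
    have hneg' : ∀ {r r' : ℝ → ℝ}, (∀ x, HasDerivAt r (r' x) x) →
        ∀ x, HasDerivAt (fun x => -r (-x)) (r' (-x)) x := fun {r r'} hr x => by
      simpa using! (hneg hr x).neg
    obtain ⟨s, hs, hint⟩ := integrableAtFilter_atTop_of_profile hα hdet hw (hneg hp) (hneg' hp')
      (hneg hq) (hneg' hq') (fun x => h1 (-x)) (fun x => h2 (-x))
      (hp0.1.comp tendsto_neg_atTop_atBot) (hq0.1.comp tendsto_neg_atTop_atBot)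
    obtain ⟨R, hR⟩ := mem_atTop_sets.1 hs
    have h := (hint.mono_set (t := s) (s := Set.Ioi (-(-R))) fun x hx =>
      hR x (by rw [neg_neg] at hx; exact le_of_lt hx)).comp_neg_Iio
    refine ⟨Set.Iio (-R), Iio_mem_atBot _, ?_⟩
    simpa using h
  · exact integrableAtFilter_atTop_of_profile hα hdet hw hp hp' hq hq' h1 h2 hp0.2 hq0.2

theorem memLp_two_of_sq_le {g G : ℝ → ℝ} (hg : Continuous g) (hG : Integrable G volume)
    (h : ∀ x, g x ^ 2 ≤ G x) : MemLp g 2 volume := by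
  rw [memLp_two_iff_integrable_sq hg.aestronglyMeasurable]
  refine hG.mono' (hg.pow 2).aestronglyMeasurable (.of_forall fun x => ?_)
  rw [Real.norm_of_nonneg (sq_nonneg _)]
  exact h x

theorem memLp_zeroAtInfty_mul (θ : C₀(ℝ, ℝ)) {g : ℝ → ℝ} (hg : MemLp g 2 volume) :
    MemLp (fun x => θ x * g x) 2 volume := by
  refine MemLp.of_le_mul (c := ‖θ.toBCF‖) hg
    (θ.continuous.aestronglyMeasurable.mul hg.aestronglyMeasurable) (.of_forall fun x => ?_)
  rw [norm_mul]
  exact mul_le_mul_of_nonneg_right (θ.toBCF.norm_coe_le_norm x) (norm_nonneg _)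

section TravelingWave

variable {a b c w : ℝ} {φ ψ : C₀(ℝ, ℝ)}

namespace IsTravelingWave

theorem hasDerivAt_deriv {f : ℝ → ℝ} (hf : ContDiff ℝ 2 f) (x : ℝ) :
    HasDerivAt f (deriv f x) x ∧ HasDerivAt (deriv f) (deriv (deriv f) x) x :=
  ⟨(hf.differentiable (by norm_num) x).hasDerivAt,
    ((hf.iterate_deriv' 1 1).differentiable (by norm_num) x).hasDerivAt⟩

theorem memLp (h : IsTravelingWave a b c w φ ψ) (hc : c < 0) (hw : |w| < 1)
    (hdet : (b * w) ^ 2 < a * c) :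
    (MemLp φ 2 volume ∧ MemLp ψ 2 volume) ∧
      MemLp (deriv φ) 2 volume ∧ MemLp (deriv ψ) 2 volume := by
  have hint := integrable_of_profile (α := -c) (β := b * w) (γ := -a) (by linarith) (by linarith) hw
    (fun x => (hasDerivAt_deriv h.contDiff_fst x).1) (fun x => (hasDerivAt_deriv h.contDiff_fst x).2)
    (fun x => (hasDerivAt_deriv h.contDiff_snd x).1) (fun x => (hasDerivAt_deriv h.contDiff_snd x).2)
    (fun x => by linear_combination -h.eq_fst x) (fun x => by linear_combination -h.eq_snd x)
    φ.zero_at_infty' ψ.zero_at_infty'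
  have hcφ : Continuous (deriv φ) := h.contDiff_fst.continuous_deriv (by norm_num)
  have hcψ : Continuous (deriv ψ) := h.contDiff_snd.continuous_deriv (by norm_num)
  refine ⟨⟨memLp_two_of_sq_le φ.continuous hint fun x => ?_,
    memLp_two_of_sq_le ψ.continuous hint fun x => ?_⟩,
    memLp_two_of_sq_le hcφ hint fun x => ?_, memLp_two_of_sq_le hcψ hint fun x => ?_⟩ <;>
  nlinarith [sq_nonneg (φ x), sq_nonneg (ψ x), sq_nonneg (deriv φ x), sq_nonneg (deriv ψ x)]

/-- The second and third derivatives of a travelling-wave profile are square-integrable, and the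
derivative of the profile solves the linearized equations. -/
theorem exists_thirdDeriv (h : IsTravelingWave a b c w φ ψ) (hc : c < 0) (hw : |w| < 1)
    (hdet : (b * w) ^ 2 < a * c) : ∃ p q : ℝ → ℝ,
    (∀ x, HasDerivAt (deriv (deriv φ)) (p x) x) ∧ (∀ x, HasDerivAt (deriv (deriv ψ)) (q x) x) ∧
    MemLp (deriv (deriv φ)) 2 volume ∧ MemLp (deriv (deriv ψ)) 2 volume ∧
    MemLp p 2 volume ∧ MemLp q 2 volume ∧
    (∀ x, deriv φ x + c * p x + (b * w * q x - w * deriv ψ x) + ψ x * deriv ψ x = 0) ∧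
    ∀ x, deriv ψ x + a * q x + (b * w * p x - w * deriv φ x) +
      (ψ x * deriv φ x + φ x * deriv ψ x) = 0 := by
  obtain ⟨⟨hφ, hψ⟩, hφ', hψ'⟩ := h.memLp hc hw hdet
  have hd : a * c - (b * w) ^ 2 ≠ 0 := by linarith
  set Δ' := a * c - (b * w) ^ 2 with hΔ'
  have hφd := fun x => (hasDerivAt_deriv h.contDiff_fst x).1
  have hψd := fun x => (hasDerivAt_deriv h.contDiff_snd x).1
  let F : ℝ → ℝ := fun x => φ x - w * ψ x + ψ x * ψ x / 2
  let G : ℝ → ℝ := fun x => ψ x - w * φ x + φ x * ψ x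
  let F' : ℝ → ℝ := fun x => deriv φ x - w * deriv ψ x + (deriv ψ x * ψ x + ψ x * deriv ψ x) / 2
  let G' : ℝ → ℝ := fun x => deriv ψ x - w * deriv φ x + (deriv φ x * ψ x + φ x * deriv ψ x)
  have hF : ∀ x, HasDerivAt F (F' x) x := fun x =>
    ((hφd x).sub ((hψd x).const_mul w)).add (((hψd x).mul (hψd x)).div_const 2)
  have hG : ∀ x, HasDerivAt G (G' x) x := fun x =>
    ((hψd x).sub ((hφd x).const_mul w)).add ((hφd x).mul (hψd x))
  -- Solving the equations for φ'' and ψ'' by Cramer's rule shows that they are differentiable,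
  -- although the profile is only assumed C².
  have e1 : deriv (deriv φ) = fun x => (-a * F x + b * w * G x) / Δ' := by
    ext x
    rw [eq_div_iff hd]
    simp only [F, G, Δ']
    linear_combination a * h.eq_fst x - b * w * h.eq_snd x
  have e2 : deriv (deriv ψ) = fun x => (b * w * F x + -c * G x) / Δ' := by
    ext x
    rw [eq_div_iff hd]
    simp only [F, G, Δ']
    linear_combination c * h.eq_snd x - b * w * h.eq_fst x
  have mF : MemLp F 2 volume := by
    refine (hφ.sub (hψ.const_mul w)).add ?_
    simpa only [div_eq_inv_mul] using (memLp_zeroAtInfty_mul ψ hψ).const_mul 2⁻¹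
  have mG : MemLp G 2 volume := (hψ.sub (hφ.const_mul w)).add (memLp_zeroAtInfty_mul φ hψ)
  have mF' : MemLp F' 2 volume := by
    refine ((hφ'.sub (hψ'.const_mul w)).add (memLp_zeroAtInfty_mul ψ hψ')).ae_eq
      (.of_forall fun x => ?_)
    simp only [F', Pi.add_apply, Pi.sub_apply]
    ring
  have mG' : MemLp G' 2 volume := by
    refine ((hψ'.sub (hφ'.const_mul w)).add ((memLp_zeroAtInfty_mul ψ hφ').add
      (memLp_zeroAtInfty_mul φ hψ'))).ae_eq (.of_forall fun x => ?_)
    simp only [G', Pi.add_apply, Pi.sub_apply]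
    ring
  have mcomb : ∀ (r s : ℝ) {f g : ℝ → ℝ}, MemLp f 2 volume → MemLp g 2 volume →
      MemLp (fun x => (r * f x + s * g x) / Δ') 2 volume := fun r s f g hf hg => by
    simpa only [div_eq_inv_mul] using! ((hf.const_mul r).add (hg.const_mul s)).const_mul Δ'⁻¹
  refine ⟨fun x => (-a * F' x + b * w * G' x) / Δ', fun x => (b * w * F' x + -c * G' x) / Δ',
    fun x => ?_, fun x => ?_, ?_, ?_, mcomb _ _ mF' mG', mcomb _ _ mF' mG', fun x => ?_, fun x => ?_⟩
  · rw [e1]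
    exact (((hF x).const_mul (-a)).add ((hG x).const_mul (b * w))).div_const Δ'
  · rw [e2]
    exact (((hF x).const_mul (b * w)).add ((hG x).const_mul (-c))).div_const Δ'
  · rw [e1]; exact mcomb _ _ mF mG
  · rw [e2]; exact mcomb _ _ mF mG
  · have : c * ((-a * F' x + b * w * G' x) / Δ') + b * w * ((b * w * F' x + -c * G' x) / Δ') =
        -F' x := by
      field_simp
      simp only [Δ']
      ring
    simp only [F'] at this ⊢
    linear_combination this
  · have : a * ((b * w * F' x + -c * G' x) / Δ') + b * w * ((-a * F' x + b * w * G' x) / Δ') =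
        -G' x := by
      field_simp
      simp only [Δ']
      ring
    simp only [G'] at this ⊢
    linear_combination this

end IsTravelingWave

end TravelingWave

end Profile

/-! ### The derivative of the profile as an element of the kernel -/

section Eigenvector

open Filter Topology

/-- The class in `L²(ℝ)` of a real square-integrable function. -/
def realLp {g : ℝ → ℝ} (hg : MemLp g 2 volume) : L2 :=
  MemLp.toLp (fun x => (g x : ℂ)) hg.ofReal

theorem coeFn_realLp {g : ℝ → ℝ} (hg : MemLp g 2 volume) :
    (realLp hg : ℝ → ℂ) =ᵐ[volume] fun x => (g x : ℂ) :=
  MemLp.coeFn_toLp _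

theorem mulPotential_realLp (θ : C₀(ℝ, ℝ)) {g : ℝ → ℝ} (hg : MemLp g 2 volume) :
    mulPotential θ (realLp hg) = realLp (memLp_zeroAtInfty_mul θ hg) := by
  apply Lp.ext
  filter_upwards [mulPotential_coeFn θ (realLp hg), coeFn_realLp hg,
    coeFn_realLp (memLp_zeroAtInfty_mul θ hg)] with x h1 h2 h3
  rw [h1, h2, h3, Complex.ofReal_mul]

theorem realLp_add {f g : ℝ → ℝ} (hf : MemLp f 2 volume) (hg : MemLp g 2 volume) :
    realLp hf + realLp hg = realLp (hf.add hg) := by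
  apply Lp.ext
  filter_upwards [Lp.coeFn_add (realLp hf) (realLp hg), coeFn_realLp hf, coeFn_realLp hg,
    coeFn_realLp (hf.add hg)] with x h1 h2 h3 h4
  rw [h1, h4, Pi.add_apply, Pi.add_apply, h2, h3, Complex.ofReal_add]

theorem realLp_sub {f g : ℝ → ℝ} (hf : MemLp f 2 volume) (hg : MemLp g 2 volume) :
    realLp hf - realLp hg = realLp (hf.sub hg) := by
  apply Lp.ext
  filter_upwards [Lp.coeFn_sub (realLp hf) (realLp hg), coeFn_realLp hf, coeFn_realLp hg,
    coeFn_realLp (hf.sub hg)] with x h1 h2 h3 h4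
  rw [h1, h4, Pi.sub_apply, Pi.sub_apply, h2, h3, Complex.ofReal_sub]

theorem smul_realLp (r : ℝ) {g : ℝ → ℝ} (hg : MemLp g 2 volume) :
    (r : ℂ) • realLp hg = realLp (hg.const_mul r) := by
  apply Lp.ext
  filter_upwards [Lp.coeFn_smul (r : ℂ) (realLp hg), coeFn_realLp hg,
    coeFn_realLp (hg.const_mul r)] with x h1 h2 h3
  rw [h1, h3, Pi.smul_apply, h2, smul_eq_mul, Complex.ofReal_mul]

theorem realLp_eq_zero {g : ℝ → ℝ} (hg : MemLp g 2 volume) (h : ∀ x, g x = 0) :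
    realLp hg = 0 := by
  apply Lp.ext
  filter_upwards [coeFn_realLp hg, Lp.coeFn_zero ℂ 2 (volume : Measure ℝ)] with x h1 h2
  rw [h1, h2, h, Complex.ofReal_zero, Pi.zero_apply]

theorem freeFst_add_eq_zero {b c w : ℝ} {u v : H2} {f f'' g g'' r : ℝ → ℝ}
    (hf : MemLp f 2 volume) (hf'' : MemLp f'' 2 volume) (hg : MemLp g 2 volume)
    (hg'' : MemLp g'' 2 volume) (hr : MemLp r 2 volume)
    (hu : (u : L2) = realLp hf) (hu'' : secondDeriv u = realLp hf'')
    (hv : (v : L2) = realLp hg) (hv'' : secondDeriv v = realLp hg'')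
    (h : ∀ x, f x + c * f'' x + (b * w * g'' x - w * g x) + r x = 0) :
    freeFst b c w u v + realLp hr = 0 := by
  rw [freeFst, hu, hu'', hv, hv'', smul_realLp, smul_realLp, smul_realLp, realLp_add, realLp_sub,
    realLp_add, realLp_add]
  exact realLp_eq_zero _ h

theorem exists_H2_of_hasDerivAt {g g' g'' : ℝ → ℝ} (h1 : ∀ x, HasDerivAt g (g' x) x)
    (h2 : ∀ x, HasDerivAt g' (g'' x) x) (hg : MemLp g 2 volume) (hg' : MemLp g' 2 volume)
    (hg'' : MemLp g'' 2 volume) :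
    ∃ u : H2, (u : L2) = realLp hg ∧ secondDeriv u = realLp hg'' := by
  obtain ⟨h, hd⟩ := mem_H2_of_hasDerivAt (fun x => (h1 x).ofReal_comp) (fun x => (h2 x).ofReal_comp)
    hg.ofReal hg'.ofReal hg''.ofReal
  exact ⟨⟨_, h⟩, rfl, hd⟩

theorem exists_eigenvector {a b c w : ℝ} {φ ψ : C₀(ℝ, ℝ)} (hc : c < 0) (hw : |w| < 1)
    (hdet : (b * w) ^ 2 < a * c) (h : IsTravelingWave a b c w φ ψ) :
    ∃ U : (linearizedOperator a b c w φ ψ).domain,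
      (U : L2Pair).fst =ᵐ[volume] (fun x => ((deriv φ x : ℝ) : ℂ)) ∧
      (U : L2Pair).snd =ᵐ[volume] (fun x => ((deriv ψ x : ℝ) : ℂ)) ∧
      linearizedOperator a b c w φ ψ U = 0 := by
  obtain ⟨-, hφ', hψ'⟩ := h.memLp hc hw hdet
  obtain ⟨p, q, hp, hq, hφ'', hψ'', mp, mq, e1, e2⟩ := h.exists_thirdDeriv hc hw hdet
  obtain ⟨u, hu, hu''⟩ := exists_H2_of_hasDerivAt
    (fun x => (IsTravelingWave.hasDerivAt_deriv h.contDiff_fst x).2) hp hφ' hφ'' mp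
  obtain ⟨v, hv, hv''⟩ := exists_H2_of_hasDerivAt
    (fun x => (IsTravelingWave.hasDerivAt_deriv h.contDiff_snd x).2) hq hψ' hψ'' mq
  obtain ⟨U, hU1, hU2, hU3, hU4⟩ := exists_domain_pair (a := a) (b := b) (c := c) (w := w)
    (φ := φ) (ψ := ψ) u v
  refine ⟨U, ?_, ?_, ?_⟩
  · rw [hU1, hu]; exact coeFn_realLp hφ'
  · rw [hU2, hv]; exact coeFn_realLp hψ'
  have z1 : (linearizedOperator a b c w φ ψ U).fst = 0 := by
    rw [linearizedOperator_fst, hU3, hU4, hv, mulPotential_realLp]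
    exact freeFst_add_eq_zero hφ' mp hψ' mq _ hu hu'' hv hv'' e1
  have z2 : (linearizedOperator a b c w φ ψ U).snd = 0 := by
    rw [linearizedOperator_snd, hU3, hU4, add_assoc, hu, hv, mulPotential_realLp,
      mulPotential_realLp, realLp_add]
    exact freeFst_add_eq_zero hψ' mq hφ' mp _ hv hv'' hu hu'' e2
  exact (WithLp.ofLp_injective 2) (Prod.ext z1 z2)

/-- Continuity upgrades almost everywhere to everywhere; a constant that vanishes at infinity is
zero. -/
theorem eq_zero_of_deriv_eq_zero {f : C₀(ℝ, ℝ)} (hf : ContDiff ℝ 2 f)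
    (h : (fun x => ((deriv f x : ℝ) : ℂ)) =ᵐ[volume] 0) : f = 0 := by
  have hc : Continuous fun x => ((deriv f x : ℝ) : ℂ) :=
    Complex.continuous_ofReal.comp (hf.continuous_deriv (by norm_num))
  have h0 : ∀ x, deriv f x = 0 := fun x => by
    have := congrFun (hc.ae_eq_iff_eq volume continuous_zero |>.1 h) x
    simpa using this
  have hconst : ∀ x, f x = f 0 := fun x =>
    is_const_of_deriv_eq_zero (hf.differentiable (by norm_num)) h0 x 0
  have hlim : Tendsto f (cocompact ℝ) (𝓝 (f 0)) :=
    tendsto_const_nhds.congr fun x => (hconst x).symm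
  have : f 0 = 0 := tendsto_nhds_unique hlim f.zero_at_infty'
  ext x
  rw [hconst, this]
  rfl

end Eigenvector

end AbcSystem

end

theorem mainTheorem5 (a b c w : ℝ) (ha : a < 0) (hc : c < 0)
    (hw : |w| < 1) (hwb : |w| * |b| < √(a * c))
    (φ ψ : C₀(ℝ, ℝ)) (hwave : AbcSystem.IsTravelingWave a b c w φ ψ)
    (hne : ¬ (φ = 0 ∧ ψ = 0)) :
    IsSelfAdjoint (AbcSystem.linearizedOperator a b c w φ ψ) ∧
    (∃ U : (AbcSystem.linearizedOperator a b c w φ ψ).domain,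
      (U : AbcSystem.L2Pair).fst =ᵐ[volume] (fun x => ((deriv φ x : ℝ) : ℂ)) ∧
      (U : AbcSystem.L2Pair).snd =ᵐ[volume] (fun x => ((deriv ψ x : ℝ) : ℂ)) ∧
      U ≠ 0 ∧
      AbcSystem.linearizedOperator a b c w φ ψ U = 0) ∧
    ∃ κ : ℝ, 0 < κ ∧
      AbcSystem.essentialSpectrum (AbcSystem.linearizedOperator a b c w φ ψ) ⊆
        Complex.ofReal '' Set.Ici κ := by
  -- The multiplied-out bound on |w| squares to ellipticity of the second-order matrix, with no
  -- separate case b = 0.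
  have hdet : (b * w) ^ 2 < a * c := by
    rw [← sq_abs, abs_mul, mul_comm |b|]
    exact (Real.lt_sqrt (by positivity)).1 hwb
  obtain ⟨⟨hφ, hψ⟩, -⟩ := hwave.memLp hc hw hdet
  obtain ⟨U, h1, h2, hU⟩ := AbcSystem.exists_eigenvector hc hw hdet hwave
  refine ⟨AbcSystem.isSelfAdjoint_linearizedOperator hdet, ⟨U, h1, h2, fun h0 => hne ?_, hU⟩,
    1 - |w|, by linarith, AbcSystem.essentialSpectrum_linearizedOperator_subset hc hw hdet hφ hψ⟩
  subst h0
  exact ⟨AbcSystem.eq_zero_of_deriv_eq_zero hwave.contDiff_fst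
      (h1.symm.trans (Lp.coeFn_zero ℂ 2 volume)),
    AbcSystem.eq_zero_of_deriv_eq_zero hwave.contDiff_snd
      (h2.symm.trans (Lp.coeFn_zero ℂ 2 volume))⟩
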